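/- Let $D$ be a skew field, $\sigma$ an automorphism of $D$, $\delta$ a $\sigma$-derivation ($\delta$ additive, $\delta(ab)=\sigma(a)\delta(b)+\delta(a)b$), and let $R=D[X;\sigma,\delta]$ be the ring of left polynomials $\sum a_iX^i$ with $Xa=\sigma(a)X+\delta(a)$. *Terminology.* A polynomial $a\in R$ is twosided if $Ra=aR$. It is prime twosided if it is twosided, of positive degree, and $Ra$ is a maximal twosided ideal. A bound of $f$ is a twosided polynomial $f^*$ with $Rf^*=\mathrm{Ann}_R(R/Rf)$; it is unique up to a nonzero factor in $D$. For $f,g\in R$, $(f,g)_r$ is a greatest common right divisor (a generator of $Rf+Rg$, computed by the Euclidean algorithm), and for $g\ne 0$, $\mathrm{lquot}(f,g)$ is the element $c$ with $f=cg+\rho$, $\deg \rho<\deg g$. *Conditions on $R$.* (1) $R$ is free of finite rank $r$ over its center $C$. (2) $C=K[z]$, where $K$ is a subfield of the center of $D$ with $\sigma(K)\subseteq K$ and $\delta(K)=0$, and $z\in R$ is nonconstant. (3) For every $f\in R$ we are given (by a subroutine) an element $\widehat f\in C$ and a finite, possibly empty, list of irreducible twosided polynomials $\nu_1,\dots,\nu_t$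 such that, with $\nu=\nu_1\cdots\nu_t$, the element $f^*=\nu\widehat f$ is a bound of $f$. *Further subroutines.* (a) One that returns, for every nonzero twosided $\alpha$, prime twosided polynomials $\pi_1,\dots,\pi_s$ $(s\ge 0)$ with $\alpha=d\,\pi_1\cdots\pi_s$ for some nonzero $d\in D$. (b) One that returns, for $\pi$ prime twosided and $f\in R$, a solution $y$ of $fyf=f$ in $R/R\pi$, if there is one. (c) $\mathrm{FindZeroDivisor}$, which for $\pi$ prime twosided, $A=R/R\pi$ and an idempotent $e\in A$ returns a zero divisor of the algebra $(1-e)A(1-e)$ (a nonzero element of it whose product, on one side, with some nonzero element of it is $0$), if there is one, and $0$ otherwise. Elements of $A$ are represented by polynomials in $R$. *Procedure $\mathrm{FactorizeIrred}(f,\pi)$.* If $f=1$, return the empty list. Otherwise, if $\deg\pi=\sqrt r\,\deg f$, return $[f]$. Otherwise compute a solution $y$ of $f=fyf$ in $A=R/R\pi$, put $e=yf$ and $\mathit{aux}=\mathrm{FindZeroDivisor}((1-e)A(1-e))$. If $\mathit{aux}=0$ in $A$, return $[f]$. Otherwise put $g=(\mathit{aux},f)_r$, $h=\mathrm{lquot}(f,g)$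 and return the concatenation of $\mathrm{FactorizeIrred}(h,\pi)$ and $\mathrm{FactorizeIrred}(g,\pi)$. *Algorithm $\mathrm{Factorize}(f)$.* Compute the bound $f^*=\widehat f\,\nu$ with $\nu=\nu_1\cdots\nu_t$, put $f_1=\mathrm{lquot}(f,\nu)$, and let $\pi_1,\dots,\pi_s$ be the output of (a) for $\widehat f$. For $i=1,\dots,s-1$ put $f_{i+1}=(f_i,\pi_{i+1}\cdots\pi_s)_r$ and $g_i=\mathrm{lquot}(f_i,f_{i+1})$; put $g_s=f_s$. Return the concatenation of $\mathrm{FactorizeIrred}(g_1,\pi_1),\dots,\mathrm{FactorizeIrred}(g_s,\pi_s)$ and $[\nu_1,\dots,\nu_t]$. (If $s=0$, return $[f_1\nu_1,\nu_2,\dots,\nu_t]$; the empty list if also $t=0$.) **Theorem.** Let $R$ satisfy conditions (1)–(3), let subroutines (a)–(c) be available, and let $f\in R$ be a nonconstant polynomial having a nonzero bound that lies in $C$. Then $\mathrm{Factorize}(f)$ terminates, and it returns a list $[p_1,\dots,p_l]$ of irreducible polynomials of $R$ with $f=p_1\cdots p_l$. -/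

import Mathlib

/-- A `σ`-derivation of `D`: an additive map `δ` with `δ (a b) = σ a δ b + δ a b`. -/
structure SkewDerivation {D : Type*} [DivisionRing D] (σ : D ≃+* D) where
  toFun : D →+ D
  map_mul : ∀ a b : D, toFun (a * b) = σ a * toFun b + toFun a * b

/-- The Ore extension `D[X;σ,δ]`.  Its elements are the left polynomials `a₀ + a₁ X + ⋯ + aₙ Xⁿ`;
as an additive group (and left `D`-vector space) it is a copy of `Polynomial D`, the product is the
one determined by `X a = σ a X + δ a`. -/
def OrePolynomial {D : Type*} [DivisionRing D] (σ : D ≃+* D) (_δ : SkewDerivation σ) : Type _ :=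
  Polynomial D

namespace OrePolynomial

noncomputable section

open Classical

variable {D : Type*} [DivisionRing D] {σ : D ≃+* D} {δ : SkewDerivation σ}

instance : AddCommGroup (OrePolynomial σ δ) := inferInstanceAs (AddCommGroup (Polynomial D))

/-- The underlying left polynomial; only additive structure is preserved. -/
def toPoly : OrePolynomial σ δ ≃+ Polynomial D := AddEquiv.refl _

/-- `monomial n a` is the left monomial `a Xⁿ`. -/
def monomial (n : ℕ) : D →+ OrePolynomial σ δ :=
  (toPoly (σ := σ) (δ := δ)).symm.toAddMonoidHom.comp (Polynomial.monomial n).toAddMonoidHom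

theorem addHom_ext {M : Type*} [AddCommMonoid M] {F G : OrePolynomial σ δ →+ M}
    (h : ∀ n a, F (monomial n a) = G (monomial n a)) : F = G :=
  Polynomial.addHom_ext (R := D) (M := M) (f := F) (g := G) h

/-- An element of `D` viewed in `D[X;σ,δ]`. -/
def const (a : D) : OrePolynomial σ δ := monomial 0 a

/-- The variable. -/
def X : OrePolynomial σ δ := monomial 1 1

/-- `deg f`, with the convention `deg 0 = 0`. -/
def natDegree (f : OrePolynomial σ δ) : ℕ := (toPoly f).natDegree

/-- The leading coefficient of a left polynomial. -/
def leadingCoeff (f : OrePolynomial σ δ) : D := (toPoly f).leadingCoeff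

/-- Additive map out of `D[X;σ,δ]` given on monomials. -/
def liftAdd {M : Type*} [AddCommMonoid M] (F : ℕ → D →+ M) : OrePolynomial σ δ →+ M where
  toFun f := (toPoly f).sum fun n a => F n a
  map_zero' := by simp
  map_add' f g := by
    rw [map_add]
    exact Polynomial.sum_add_index _ _ _ (fun n => map_zero _) (fun n a b => map_add _ _ _)

theorem liftAdd_monomial {M : Type*} [AddCommMonoid M] (F : ℕ → D →+ M) (n : ℕ) (a : D) :
    liftAdd F (monomial n a : OrePolynomial σ δ) = F n a :=
  Polynomial.sum_monomial_index (R := D) a (fun n a => F n a) (map_zero (F n))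

/-- Left multiplication by a constant `a`: `b Xⁿ ↦ (a b) Xⁿ`. -/
def lmulConst (a : D) : OrePolynomial σ δ →+ OrePolynomial σ δ :=
  liftAdd fun n => (monomial n).comp (AddMonoidHom.mulLeft a)

/-- Left multiplication by `X`: `b Xⁿ ↦ σ b Xⁿ⁺¹ + δ b Xⁿ`. -/
def lmulX : OrePolynomial σ δ →+ OrePolynomial σ δ :=
  liftAdd fun n => (monomial (n + 1)).comp (σ : D →+ D) + (monomial n).comp δ.toFun

theorem lmulConst_monomial (a : D) (n : ℕ) (b : D) :
    lmulConst a (monomial n b : OrePolynomial σ δ) = monomial n (a * b) := by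
  simp [lmulConst, liftAdd_monomial]

theorem lmulX_monomial (n : ℕ) (b : D) :
    lmulX (monomial n b : OrePolynomial σ δ) =
      monomial (n + 1) (σ b) + monomial n (δ.toFun b) := by
  simp [lmulX, liftAdd_monomial]

theorem lmulConst_add (a b : D) :
    (lmulConst (a + b) : OrePolynomial σ δ →+ OrePolynomial σ δ) = lmulConst a + lmulConst b := by
  apply addHom_ext
  intro n c
  simp [lmulConst_monomial, add_mul]

theorem lmulConst_comp (a b : D) (h : OrePolynomial σ δ) :
    lmulConst (a * b) h = lmulConst a (lmulConst b h) := by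
  have : (lmulConst (a * b) : OrePolynomial σ δ →+ OrePolynomial σ δ)
      = (lmulConst a).comp (lmulConst b) := by
    apply addHom_ext
    intro n c
    simp [lmulConst_monomial, mul_assoc]
  exact DFunLike.congr_fun this h

theorem lmulX_lmulConst (a : D) (h : OrePolynomial σ δ) :
    lmulX (lmulConst a h) = lmulConst (σ a) (lmulX h) + lmulConst (δ.toFun a) h := by
  have : (lmulX.comp (lmulConst a) : OrePolynomial σ δ →+ OrePolynomial σ δ)
      = (lmulConst (σ a)).comp lmulX + lmulConst (δ.toFun a) := by
    apply addHom_ext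
    intro n c
    simp [lmulConst_monomial, lmulX_monomial, δ.map_mul, add_assoc]
  exact DFunLike.congr_fun this h

theorem lmulConst_one (h : OrePolynomial σ δ) : lmulConst 1 h = h := by
  have : (lmulConst 1 : OrePolynomial σ δ →+ OrePolynomial σ δ) = AddMonoidHom.id _ := by
    apply addHom_ext
    intro n c
    simp [lmulConst_monomial]
  exact DFunLike.congr_fun this h

/-- Left multiplication by `Xⁿ`. -/
def lmulXPow : ℕ → (OrePolynomial σ δ →+ OrePolynomial σ δ)
  | 0 => AddMonoidHom.id _
  | n + 1 => lmulX.comp (lmulXPow n)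

/-- The product: `(∑ aₙ Xⁿ) g = ∑ aₙ (Xⁿ g)`, where `Xⁿ g` is computed with
`X (b Xᵐ) = σ b Xᵐ⁺¹ + δ b Xᵐ`. -/
def mulHom : OrePolynomial σ δ →+ OrePolynomial σ δ →+ OrePolynomial σ δ :=
  liftAdd fun n =>
    { toFun := fun a => (lmulConst a).comp (lmulXPow n)
      map_zero' := by
        have h0 : (lmulConst (0 : D) : OrePolynomial σ δ →+ OrePolynomial σ δ) = 0 := by
          have := lmulConst_add (σ := σ) (δ := δ) (0 : D) 0
          simpa using this
        rw [h0, AddMonoidHom.zero_comp]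
      map_add' := fun a b => by rw [lmulConst_add, AddMonoidHom.add_comp] }

instance : Mul (OrePolynomial σ δ) := ⟨fun f g => mulHom f g⟩

instance : One (OrePolynomial σ δ) := ⟨monomial 0 1⟩

theorem mul_eq (f g : OrePolynomial σ δ) : f * g = mulHom f g := rfl

theorem one_eq : (1 : OrePolynomial σ δ) = monomial 0 1 := rfl

theorem monomial_mul (n : ℕ) (a : D) (g : OrePolynomial σ δ) :
    monomial n a * g = lmulConst a (lmulXPow n g) := by
  rw [mul_eq, mulHom, liftAdd_monomial]
  rfl

theorem lmulConst_mul (a : D) (f g : OrePolynomial σ δ) :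
    lmulConst a f * g = lmulConst a (f * g) := by
  have : (mulHom.flip g).comp (lmulConst a) = (lmulConst a).comp (mulHom.flip g) := by
    apply addHom_ext
    intro n c
    have h1 := monomial_mul (σ := σ) (δ := δ) n (a * c) g
    have h2 := monomial_mul (σ := σ) (δ := δ) n c g
    simp only [AddMonoidHom.comp_apply, AddMonoidHom.flip_apply, lmulConst_monomial,
      ← mul_eq, h1, h2, lmulConst_comp]
  exact DFunLike.congr_fun this f

theorem lmulX_mul (f g : OrePolynomial σ δ) : lmulX f * g = lmulX (f * g) := by
  have : (mulHom.flip g).comp lmulX = lmulX.comp (mulHom.flip g) := by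
    apply addHom_ext
    intro n c
    have h2 := monomial_mul (σ := σ) (δ := δ) n c g
    simp only [AddMonoidHom.comp_apply, AddMonoidHom.flip_apply, lmulX_monomial, map_add,
      ← mul_eq, monomial_mul, lmulX_lmulConst]
    rfl
  exact DFunLike.congr_fun this f

theorem lmulXPow_mul (n : ℕ) (f g : OrePolynomial σ δ) :
    lmulXPow n f * g = lmulXPow n (f * g) := by
  induction n with
  | zero => rfl
  | succ n ih =>
    change lmulX (lmulXPow n f) * g = lmulX (lmulXPow n (f * g))
    rw [lmulX_mul, ih]

theorem lmulXPow_one (n : ℕ) : lmulXPow n (1 : OrePolynomial σ δ) = monomial n 1 := by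
  induction n with
  | zero => rfl
  | succ n ih =>
    change lmulX (lmulXPow n 1) = _
    have hd : δ.toFun 1 = 0 := by
      have := δ.map_mul 1 1
      simpa using this
    rw [ih, lmulX_monomial, map_one, hd, map_zero, add_zero]

instance : Ring (OrePolynomial σ δ) :=
  { (inferInstance : AddCommGroup (OrePolynomial σ δ)),
    (inferInstance : Mul (OrePolynomial σ δ)),
    (inferInstance : One (OrePolynomial σ δ)) with
    left_distrib := fun f g h => map_add (mulHom f) g h
    right_distrib := fun f g h => by
      change mulHom (f + g) h = mulHom f h + mulHom g h
      rw [map_add]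
      rfl
    zero_mul := fun f => by
      change mulHom 0 f = 0
      rw [map_zero]
      rfl
    mul_zero := fun f => map_zero (mulHom f)
    mul_assoc := fun f g h => by
      have : (mulHom.flip h).comp (mulHom.flip g) = mulHom.flip (g * h) := by
        apply addHom_ext
        intro n c
        simp only [AddMonoidHom.comp_apply, AddMonoidHom.flip_apply, ← mul_eq, monomial_mul,
          lmulConst_mul, lmulXPow_mul]
      exact DFunLike.congr_fun this f
    one_mul := fun f => by
      rw [one_eq, monomial_mul, lmulConst_one]
      rfl
    mul_one := fun f => by
      have : mulHom.flip (1 : OrePolynomial σ δ) = AddMonoidHom.id _ := by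
        apply addHom_ext
        intro n c
        simp only [AddMonoidHom.flip_apply, ← mul_eq, monomial_mul, lmulXPow_one,
          lmulConst_monomial, mul_one, AddMonoidHom.id_apply]
      exact DFunLike.congr_fun this f }

theorem const_mul_X_pow (a : D) (n : ℕ) :
    (const a * X ^ n : OrePolynomial σ δ) = monomial n a := by
  have hX : (X ^ n : OrePolynomial σ δ) = monomial n 1 := by
    rw [← lmulXPow_one]
    induction n with
    | zero => rfl
    | succ n ih =>
      rw [pow_succ', ih, X, monomial_mul, lmulConst_one]
      rfl
  rw [hX, const, monomial_mul]
  change lmulConst a (monomial n 1) = _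
  rw [lmulConst_monomial, mul_one]

/-- The defining commutation rule of the Ore extension. -/
theorem X_mul_const (a : D) :
    (X * const a : OrePolynomial σ δ) = const (σ a) * X + const (δ.toFun a) := by
  have h := const_mul_X_pow (σ := σ) (δ := δ) (σ a) 1
  rw [pow_one] at h
  rw [h, X, const, monomial_mul, lmulConst_one]
  exact lmulX_monomial 0 a

theorem const_mul_const (a b : D) :
    (const a * const b : OrePolynomial σ δ) = const (a * b) := by
  rw [const, monomial_mul]
  exact lmulConst_monomial a 0 b

/-- Main loop of the left Euclidean division by `g`; the first argument only bounds the number of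
passes through the loop. -/
def divLoop (g : OrePolynomial σ δ) :
    ℕ → OrePolynomial σ δ → OrePolynomial σ δ → OrePolynomial σ δ × OrePolynomial σ δ
  | 0, c, r => (c, r)
  | n + 1, c, r =>
    if r ≠ 0 ∧ natDegree g ≤ natDegree r then
      let k := natDegree r - natDegree g
      let m := monomial k (leadingCoeff r * σ^[k] (leadingCoeff g)⁻¹)
      divLoop g n (c + m) (r - m * g)
    else (c, r)

/-- Left quotient: `f = lquot f g * g + lrem f g` with `deg (lrem f g) < deg g`.  The degree of the
running remainder drops in every pass, so `deg f + 1` passes are enough. -/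
def lquot (f g : OrePolynomial σ δ) : OrePolynomial σ δ := (divLoop g (natDegree f + 1) 0 f).1

/-- Left remainder. -/
def lrem (f g : OrePolynomial σ δ) : OrePolynomial σ δ := (divLoop g (natDegree f + 1) 0 f).2

/-- Main loop of the left Euclidean algorithm; the first argument only bounds the number of
passes through the loop. -/
def rgdLoop : ℕ → OrePolynomial σ δ → OrePolynomial σ δ → OrePolynomial σ δ
  | 0, f₀, _ => f₀
  | n + 1, f₀, f₁ => if f₁ = 0 then f₀ else rgdLoop n f₁ (lrem f₀ f₁)

/-- The right greatest common divisor `(f, g)_r`, a generator of the left ideal `R f + R g`. -/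
def rgd (f g : OrePolynomial σ δ) : OrePolynomial σ δ := rgdLoop (natDegree g + 1) f g

/-- `a` is a twosided (normal) polynomial: `R a = a R`. -/
def IsTwosided (a : OrePolynomial σ δ) : Prop :=
  Set.range (fun r : OrePolynomial σ δ => r * a) = Set.range (fun r : OrePolynomial σ δ => a * r)

/-- `b` is a bound of `f`: `b` is twosided and `R b = Ann_R (R / R f)`.  (`Ideal.span` is the left
ideal generated by a set.) -/
def IsBound (f b : OrePolynomial σ δ) : Prop :=
  IsTwosided b ∧
    Ideal.span {b} =
      Module.annihilator (OrePolynomial σ δ) (OrePolynomial σ δ ⧸ Ideal.span {f})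

/-- `π` is a prime twosided polynomial: it is twosided of positive degree and the twosided ideal
`R π` is maximal among the proper twosided ideals. -/
def IsPrimeTwosided (π : OrePolynomial σ δ) : Prop :=
  IsTwosided π ∧ 0 < natDegree π ∧ IsCoatom (TwoSidedIdeal.span {π})

/-- The ring `A = R / R π`, for a twosided polynomial `π` (then `R π` is the twosided ideal
generated by `π`). -/
abbrev Quo (π : OrePolynomial σ δ) : Type _ := (TwoSidedIdeal.span {π}).ringCon.Quotient

/-- The class of a polynomial in `R / R π`. -/
def toQuo (π : OrePolynomial σ δ) : OrePolynomial σ δ →+* Quo π :=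
  (TwoSidedIdeal.span {π}).ringCon.mk'

/-- The subset `(1 - e) A (1 - e)` of a ring `A`. -/
def cornerSet {A : Type*} [Ring A] (e : A) : Set A := {x | ∃ a, x = (1 - e) * a * (1 - e)}

/-- `x` is a zero divisor of the algebra `(1 - e) A (1 - e)`. -/
def IsCornerZeroDivisor {A : Type*} [Ring A] (e x : A) : Prop :=
  x ∈ cornerSet e ∧ x ≠ 0 ∧ ∃ y ∈ cornerSet e, y ≠ 0 ∧ (x * y = 0 ∨ y * x = 0)

/-- Structural conditions on `R = D[X;σ,δ]`: it is free of finite rank over its center, and the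
center is `K[z]` for a nonconstant `z ∈ R` and a subfield `K` of the center of `D` which is
invariant under `σ` and killed by `δ`. -/
structure CenterConditions (K : Subfield D) (z : OrePolynomial σ δ) : Prop where
  free : Module.Free (Subring.center (OrePolynomial σ δ)) (OrePolynomial σ δ)
  finite : Module.Finite (Subring.center (OrePolynomial σ δ)) (OrePolynomial σ δ)
  central : ∀ k ∈ K, k ∈ Subring.center D
  invariant : ∀ k ∈ K, σ k ∈ K
  killed : ∀ k ∈ K, δ.toFun k = 0
  nonconstant : 0 < natDegree z
  center_eq : Subring.center (OrePolynomial σ δ) =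
    Subring.closure (const '' (K : Set D) ∪ {z})

/-- The subroutines called by the factorization procedure.  Elements of `R / R π` are handed over
through representatives in `R`. -/
structure Subroutines (σ : D ≃+* D) (δ : SkewDerivation σ) where
  /-- the part `f̂` of the bound `f* = ν f̂` that lies in the center -/
  hat : OrePolynomial σ δ → OrePolynomial σ δ
  /-- the irreducible twosided factors `ν₁, …, νₜ` of the tame normal factor `ν` of `f*` -/
  tame : OrePolynomial σ δ → List (OrePolynomial σ δ)
  /-- factorization of twosided polynomials -/
  factor : OrePolynomial σ δ → List (OrePolynomial σ δ)
  /-- `solve π f` represents a solution `y` of `f = f y f` in `R / R π` -/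
  solve : OrePolynomial σ δ → OrePolynomial σ δ → OrePolynomial σ δ
  /-- `findZeroDivisor π e` represents the output of the zero divisor algorithm for the input
  algebra `(1 - e) A (1 - e)`, where `A = R / R π` -/
  findZeroDivisor : OrePolynomial σ δ → OrePolynomial σ δ → OrePolynomial σ δ

/-- The specifications of the subroutines. -/
structure Subroutines.Correct (S : Subroutines σ δ) : Prop where
  hat_mem : ∀ f, S.hat f ∈ Subring.center (OrePolynomial σ δ)
  tame_spec : ∀ f, ∀ ν ∈ S.tame f, Irreducible ν ∧ IsTwosided ν
  isBound : ∀ f, IsBound f ((S.tame f).prod * S.hat f)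
  factor_prime : ∀ a, a ≠ 0 → IsTwosided a → ∀ π ∈ S.factor a, IsPrimeTwosided π
  factor_prod : ∀ a, a ≠ 0 → IsTwosided a → ∃ d : D, d ≠ 0 ∧ a = const d * (S.factor a).prod
  /-- a solution is returned whenever there is one -/
  solve_spec : ∀ π f, IsPrimeTwosided π →
    (∃ y : Quo π, toQuo π f * y * toQuo π f = toQuo π f) →
      toQuo π f * toQuo π (S.solve π f) * toQuo π f = toQuo π f
  /-- a zero divisor is returned if there is one … -/
  findZeroDivisor_spec : ∀ π e, IsPrimeTwosided π → IsIdempotentElem (toQuo π e) →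
    (∃ x : Quo π, IsCornerZeroDivisor (toQuo π e) x) →
      IsCornerZeroDivisor (toQuo π e) (toQuo π (S.findZeroDivisor π e))
  /-- … and `0` otherwise -/
  findZeroDivisor_zero : ∀ π e, IsPrimeTwosided π → IsIdempotentElem (toQuo π e) →
    (¬ ∃ x : Quo π, IsCornerZeroDivisor (toQuo π e) x) → toQuo π (S.findZeroDivisor π e) = 0

/-- Procedure `FactorizeIrred` on a polynomial `f` whose bound `π` is a prime twosided polynomial.
The first argument bounds the depth of the recursion; the value is `none` if this depth is not
enough. -/
def factorizeIrred (S : Subroutines σ δ) :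
    ℕ → OrePolynomial σ δ → OrePolynomial σ δ → Option (List (OrePolynomial σ δ))
  | 0, _, _ => none
  | n + 1, f, π =>
    if f = 1 then some []
    else if (natDegree π : ℝ) =
        √(Module.finrank (Subring.center (OrePolynomial σ δ)) (OrePolynomial σ δ) : ℝ)
          * natDegree f then
      some [f]
    else
      let y := S.solve π f
      let e := y * f
      let aux := S.findZeroDivisor π e
      if toQuo π aux = 0 then some [f]
      else
        let g := rgd aux f
        let h := lquot f g
        (factorizeIrred S n h π).bind fun L =>
          (factorizeIrred S n g π).bind fun L' => some (L ++ L')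

/-- The loop that splits `f₁ = g₁ ⋯ gₛ` along `π₁, …, πₛ`: with
`fᵢ₊₁ = (fᵢ, πᵢ₊₁ ⋯ πₛ)_r` and `gᵢ = lquot fᵢ fᵢ₊₁` for `i < s`, and `gₛ = fₛ`,
it returns the list of the pairs `(gᵢ, πᵢ)`. -/
def splitLoop :
    OrePolynomial σ δ → List (OrePolynomial σ δ) → List (OrePolynomial σ δ × OrePolynomial σ δ)
  | _, [] => []
  | f, [π] => [(f, π)]
  | f, π :: π' :: πs =>
    let f' := rgd f (π' :: πs).prod
    (lquot f f', π) :: splitLoop f' (π' :: πs)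

/-- Multiplies the first member of a list by `c` on the left. -/
def absorb (c : OrePolynomial σ δ) : List (OrePolynomial σ δ) → List (OrePolynomial σ δ)
  | [] => []
  | ν :: νs => (c * ν) :: νs

/-- Procedure `Factorize`.  The first argument bounds the depth of the recursion in
`FactorizeIrred`; the value is `none` if this depth is not enough.  If `f̂` is a constant (`s = 0`),
then `f₁` is a constant and it is absorbed by `ν₁`. -/
def factorize (S : Subroutines σ δ) (n : ℕ) (f : OrePolynomial σ δ) :
    Option (List (OrePolynomial σ δ)) :=
  let νs := S.tame f
  let f₁ := lquot f νs.prod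
  match S.factor (S.hat f) with
  | [] => some (absorb f₁ νs)
  | π :: πs =>
    ((splitLoop f₁ (π :: πs)).mapM fun p => factorizeIrred S n p.1 p.2).bind fun outs =>
      some (outs.flatten ++ νs)

end

end OrePolynomial

/-! Degrees add in `R`, so `R` is a domain with left Euclidean division. Everything is expressed
through left ideals: `g` is a right divisor of `f` exactly when `f ∈ Ideal.span {g}`.

Peeling off `ν`: if an irreducible twosided `p` is a right factor of a bound `c p` of `f` but not of
`f`, then `1 ∈ R f + R p`, and `c` alone already annihilates `R / R f`, against the minimality of
the bound. Repeating this (`IsBound.exists_eq_mul_prod`) leaves `f = f₁ ν` with bound `f̂`, which up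
to a unit is `π₁ ⋯ πₛ`. Here the `πᵢ` may repeat.

Splitting `f₁`: for `f' = (f₁, π₂ ⋯ πₛ)_r` one has `π₁ f' ∈ R f₁`. Hence the quotient `g₁` is a
right divisor of `π₁`, and `f'` has bound exactly `π₂ ⋯ πₛ`. The exactness of the bounds keeps every
`gᵢ` nonconstant (`splitLoop_spec`).

Factoring a right divisor `f` of a prime twosided `π`: the ring `A = R / R π` is simple and finite
over its center, so `A ≅ Mₙ(E)` with `n² ≤ r`. If `e = y f` then `A e = A f`. A proper right divisor
of `f` gives a left ideal strictly between `A e` and `A`, and semisimplicity turns it into a zero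
divisor of `(1 - e) A (1 - e)` (`exists_isCornerZeroDivisor`). Conversely, a zero divisor `x` of the
corner does not generate `A (1 - e)` (`IsCornerZeroDivisor.mul_ne`), so `(x, f)_r` is a proper
divisor (`rgd_findZeroDivisor_spec`).

The degree test is sound because `A` embeds into `(R / R q)ⁿ` for each nonconstant right divisor `q`
of `π`. Comparing dimensions over `D` gives `deg π ≤ √r deg q`
(`IsPrimeTwosided.natDegree_le_sqrt_mul`), so a polynomial attaining equality has no proper right
factor. -/

namespace OrePolynomial

noncomputable section

open Classical

variable {D : Type*} [DivisionRing D] {σ : D ≃+* D} {δ : SkewDerivation σ}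

/-! ### Coefficients, degrees and units; `R` is a domain -/

/-- The coefficient of `Xⁿ`. -/
def coeff (n : ℕ) : OrePolynomial σ δ →+ D where
  toFun f := (toPoly f).coeff n
  map_zero' := by simp
  map_add' f g := by simp

theorem coeff_monomial (n m : ℕ) (a : D) :
    coeff n (monomial m a : OrePolynomial σ δ) = if m = n then a else 0 :=
  Polynomial.coeff_monomial

theorem ext_coeff {f g : OrePolynomial σ δ} (h : ∀ n, coeff n f = coeff n g) : f = g :=
  Polynomial.ext (R := D) (p := f) (q := g) h

theorem leadingCoeff_eq (f : OrePolynomial σ δ) : leadingCoeff f = coeff (natDegree f) f := rfl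

theorem leadingCoeff_ne_zero {f : OrePolynomial σ δ} (h : f ≠ 0) : leadingCoeff f ≠ 0 :=
  (Polynomial.leadingCoeff_ne_zero (p := (toPoly f))).2 h

theorem coeff_eq_zero_of_lt {f : OrePolynomial σ δ} {n : ℕ} (h : natDegree f < n) :
    coeff n f = 0 :=
  Polynomial.coeff_eq_zero_of_natDegree_lt (p := toPoly f) h

theorem natDegree_le_iff {f : OrePolynomial σ δ} {n : ℕ} :
    natDegree f ≤ n ↔ ∀ m, n < m → coeff m f = 0 :=
  Polynomial.natDegree_le_iff_coeff_eq_zero (p := toPoly f)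

theorem natDegree_eq_of {f : OrePolynomial σ δ} {n : ℕ} (h : ∀ m, n < m → coeff m f = 0)
    (hn : coeff n f ≠ 0) : natDegree f = n :=
  le_antisymm (natDegree_le_iff.2 h) (Polynomial.le_natDegree_of_ne_zero (p := toPoly f) hn)

theorem natDegree_sub_le {f g : OrePolynomial σ δ} {n : ℕ} (hf : natDegree f ≤ n)
    (hg : natDegree g ≤ n) : natDegree (f - g) ≤ n := by
  rw [natDegree_le_iff] at *
  intro m hm
  rw [map_sub, hf m hm, hg m hm, sub_zero]

theorem natDegree_const (a : D) : natDegree (const a : OrePolynomial σ δ) = 0 :=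
  Polynomial.natDegree_C a

theorem eq_const_of_natDegree_eq_zero {f : OrePolynomial σ δ} (h : natDegree f = 0) :
    f = const (coeff 0 f) :=
  Polynomial.eq_C_of_natDegree_eq_zero (p := toPoly f) h

theorem const_one : (const 1 : OrePolynomial σ δ) = 1 := rfl

theorem natDegree_one : natDegree (1 : OrePolynomial σ δ) = 0 := natDegree_const 1

theorem const_ne_zero {a : D} (h : a ≠ 0) : (const a : OrePolynomial σ δ) ≠ 0 :=
  (Polynomial.C_ne_zero (R := D)).2 h

theorem coeff_lmulConst (a : D) (n : ℕ) (f : OrePolynomial σ δ) :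
    coeff n (lmulConst a f) = a * coeff n f := by
  have : ((coeff n).comp (lmulConst a) : OrePolynomial σ δ →+ D)
      = (AddMonoidHom.mulLeft a).comp (coeff n) := by
    apply addHom_ext
    intro m c
    simp [lmulConst_monomial, coeff_monomial]
  exact DFunLike.congr_fun this f

theorem coeff_succ_lmulX (n : ℕ) (f : OrePolynomial σ δ) :
    coeff (n + 1) (lmulX f) = σ (coeff n f) + δ.toFun (coeff (n + 1) f) := by
  have : ((coeff (n + 1)).comp lmulX : OrePolynomial σ δ →+ D)
      = (σ : D →+ D).comp (coeff n) + δ.toFun.comp (coeff (n + 1)) := by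
    apply addHom_ext
    intro m c
    simp only [AddMonoidHom.comp_apply, lmulX_monomial, map_add, coeff_monomial,
      AddMonoidHom.add_apply]
    congr 1
    · by_cases h : m = n <;> simp [h]
    · by_cases h : m = n + 1 <;> simp [h]
  exact DFunLike.congr_fun this f

theorem coeff_lmulXPow_of_lt (n : ℕ) (f : OrePolynomial σ δ) {m : ℕ} (h : natDegree f + n < m) :
    coeff m (lmulXPow n f) = 0 := by
  induction n generalizing m with
  | zero => exact coeff_eq_zero_of_lt (f := f) (by omega)
  | succ n ih =>
    obtain ⟨m, rfl⟩ : ∃ k, m = k + 1 := ⟨m - 1, by omega⟩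
    change coeff (m + 1) (lmulX (lmulXPow n f)) = 0
    rw [coeff_succ_lmulX, ih (by omega), ih (by omega), map_zero, map_zero, add_zero]

theorem coeff_lmulXPow_top (n : ℕ) (f : OrePolynomial σ δ) :
    coeff (natDegree f + n) (lmulXPow n f) = σ^[n] (leadingCoeff f) := by
  induction n with
  | zero => rfl
  | succ n ih =>
    change coeff (natDegree f + n + 1) (lmulX (lmulXPow n f)) = _
    rw [coeff_succ_lmulX, ih, coeff_lmulXPow_of_lt _ _ (by omega), map_zero, add_zero,
      Function.iterate_succ_apply']

theorem coeff_mul (f g : OrePolynomial σ δ) (m : ℕ) :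
    coeff m (f * g) = ∑ n ∈ (toPoly f).support, coeff n f * coeff m (lmulXPow n g) := by
  have : f * g = ∑ n ∈ (toPoly f).support, lmulConst (coeff n f) (lmulXPow n g) := by
    change (∑ n ∈ (toPoly f).support, _ : OrePolynomial σ δ →+ OrePolynomial σ δ) g = _
    rw [AddMonoidHom.finsetSum_apply]
    rfl
  rw [this, map_sum]
  exact Finset.sum_congr rfl fun n _ => coeff_lmulConst _ _ _

theorem coeff_mul_of_lt (f g : OrePolynomial σ δ) {m : ℕ} (h : natDegree f + natDegree g < m) :
    coeff m (f * g) = 0 := by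
  rw [coeff_mul]
  refine Finset.sum_eq_zero fun n hn => ?_
  have : n ≤ natDegree f := Polynomial.le_natDegree_of_mem_supp (p := toPoly f) n hn
  rw [coeff_lmulXPow_of_lt _ _ (by omega), mul_zero]

/-- Moving the leading coefficient of `g` past each `X` applies `σ` once; the terms produced by `δ`
land in lower degrees. -/
theorem coeff_mul_top (f g : OrePolynomial σ δ) :
    coeff (natDegree f + natDegree g) (f * g) =
      leadingCoeff f * σ^[natDegree f] (leadingCoeff g) := by
  rw [coeff_mul, Finset.sum_eq_single (natDegree f)]
  · rw [add_comm (natDegree f), coeff_lmulXPow_top]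
    rfl
  · intro n hn hne
    have : n ≤ natDegree f := Polynomial.le_natDegree_of_mem_supp (p := toPoly f) n hn
    rw [coeff_lmulXPow_of_lt _ _ (by omega), mul_zero]
  · intro h
    have : coeff (natDegree f) f = 0 := by simpa [coeff] using h
    rw [this, zero_mul]

theorem iterate_ne_zero (σ : D ≃+* D) (n : ℕ) {a : D} (h : a ≠ 0) : σ^[n] a ≠ 0 := by
  induction n with
  | zero => exact h
  | succ n ih =>
    rw [Function.iterate_succ_apply']
    simpa using ih

theorem coeff_mul_top_ne_zero {f g : OrePolynomial σ δ} (hf : f ≠ 0) (hg : g ≠ 0) :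
    coeff (natDegree f + natDegree g) (f * g) ≠ 0 := by
  rw [coeff_mul_top]
  exact mul_ne_zero (leadingCoeff_ne_zero hf) (iterate_ne_zero σ _ (leadingCoeff_ne_zero hg))

theorem natDegree_mul {f g : OrePolynomial σ δ} (hf : f ≠ 0) (hg : g ≠ 0) :
    natDegree (f * g) = natDegree f + natDegree g :=
  natDegree_eq_of (fun _ hm => coeff_mul_of_lt f g hm) (coeff_mul_top_ne_zero hf hg)

instance : Nontrivial (OrePolynomial σ δ) := ⟨⟨const 1, 0, const_ne_zero one_ne_zero⟩⟩

instance : NoZeroDivisors (OrePolynomial σ δ) where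
  eq_zero_or_eq_zero_of_mul_eq_zero {f g} h := by
    by_contra! hne
    exact coeff_mul_top_ne_zero hne.1 hne.2 (by rw [h, map_zero])

instance : IsDomain (OrePolynomial σ δ) := NoZeroDivisors.to_isDomain _

theorem isUnit_const {a : D} (h : a ≠ 0) : IsUnit (const a : OrePolynomial σ δ) :=
  ⟨⟨const a, const a⁻¹, by rw [const_mul_const, mul_inv_cancel₀ h, const_one],
    by rw [const_mul_const, inv_mul_cancel₀ h, const_one]⟩, rfl⟩

theorem isUnit_iff {f : OrePolynomial σ δ} : IsUnit f ↔ f ≠ 0 ∧ natDegree f = 0 := by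
  constructor
  · intro h
    obtain ⟨g, hg⟩ := h.exists_left_inv
    have hg0 : g ≠ 0 := by rintro rfl; simp at hg
    have := natDegree_mul hg0 h.ne_zero
    rw [hg, natDegree_one] at this
    exact ⟨h.ne_zero, by omega⟩
  · rintro ⟨h0, h⟩
    have he := eq_const_of_natDegree_eq_zero h
    rw [he]
    refine isUnit_const fun h1 => h0 ?_
    rw [he, h1]
    exact map_zero (monomial 0)

theorem natDegree_pos_of_not_isUnit {f : OrePolynomial σ δ} (h0 : f ≠ 0) (h : ¬IsUnit f) :
    0 < natDegree f := by
  rw [isUnit_iff] at h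
  rw [Nat.pos_iff_ne_zero]
  tauto

/-! ### Euclidean division and greatest common right divisors -/

theorem divLoop_spec {g : OrePolynomial σ δ} (hg : g ≠ 0) (n : ℕ) (c r : OrePolynomial σ δ)
    (h : r = 0 ∨ natDegree r < n) :
    (divLoop g n c r).1 * g + (divLoop g n c r).2 = c * g + r ∧
      ((divLoop g n c r).2 = 0 ∨ natDegree (divLoop g n c r).2 < natDegree g) := by
  induction n generalizing c r with
  | zero => exact ⟨rfl, Or.inl (by simpa [divLoop] using h)⟩
  | succ n ih =>
    rw [divLoop]
    split_ifs with hc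
    · set k := natDegree r - natDegree g with hk
      set a := leadingCoeff r * σ^[k] (leadingCoeff g)⁻¹ with ha
      have ha0 : a ≠ 0 := mul_ne_zero (leadingCoeff_ne_zero hc.1)
        (iterate_ne_zero σ _ (inv_ne_zero (leadingCoeff_ne_zero hg)))
      have hm0 : (monomial k a : OrePolynomial σ δ) ≠ 0 := fun h0 => ha0 <| by
        have := congrArg (coeff k) h0
        simpa [coeff_monomial] using this
      have hdm : natDegree (monomial k a : OrePolynomial σ δ) = k :=
        natDegree_eq_of (fun m hm => by rw [coeff_monomial, if_neg (by omega)])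
          (by rw [coeff_monomial, if_pos rfl]; exact ha0)
      have hlm : leadingCoeff (monomial k a : OrePolynomial σ δ) = a := by
        rw [leadingCoeff_eq, hdm, coeff_monomial, if_pos rfl]
      have hdeg : k + natDegree g = natDegree r := by omega
      -- The factor `σ^[k] (leadingCoeff g)⁻¹` in `a` compensates the twist caused by `X ^ k`, so
      -- the leading terms of `r` and of the subtracted multiple of `g` agree.
      have htop : coeff (natDegree r) (monomial k a * g) = leadingCoeff r := by
        have := coeff_mul_top (monomial k a) g
        rw [hdm, hlm, hdeg] at this
        rw [this, ha, mul_assoc]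
        have hσ : σ^[k] (leadingCoeff g)⁻¹ * σ^[k] (leadingCoeff g) = 1 := by
          clear_value k
          clear * - hg
          induction k with
          | zero => simpa using inv_mul_cancel₀ (leadingCoeff_ne_zero hg)
          | succ k ih => rw [Function.iterate_succ_apply', Function.iterate_succ_apply', ← map_mul,
              ih, map_one]
        rw [hσ, mul_one]
      have hle : natDegree (r - monomial k a * g) ≤ natDegree r := by
        refine natDegree_sub_le le_rfl ?_
        rw [natDegree_mul hm0 hg, hdm, hdeg]
      have hlow : r - monomial k a * g = 0 ∨ natDegree (r - monomial k a * g) < n := by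
        by_cases h0 : r - monomial k a * g = 0
        · exact Or.inl h0
        · right
          have hlt : natDegree r < n + 1 := h.resolve_left hc.1
          rcases hle.lt_or_eq with h1 | h1
          · omega
          · exfalso
            apply leadingCoeff_ne_zero h0
            rw [leadingCoeff_eq, h1, map_sub, htop, leadingCoeff_eq, sub_self]
      obtain ⟨h1, h2⟩ := ih (c + monomial k a) (r - monomial k a * g) hlow
      refine ⟨?_, h2⟩
      rw [h1, add_mul]
      abel
    · refine ⟨rfl, ?_⟩
      simp only [not_and, not_le] at hc
      by_cases h0 : r = 0
      · exact Or.inl h0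
      · exact Or.inr (hc h0)

/-- Left division with remainder. -/
theorem lquot_mul_add_lrem {g : OrePolynomial σ δ} (hg : g ≠ 0) (f : OrePolynomial σ δ) :
    lquot f g * g + lrem f g = f := by
  have := (divLoop_spec hg (natDegree f + 1) 0 f (Or.inr (by omega))).1
  rwa [zero_mul, zero_add] at this

theorem lrem_degree {g : OrePolynomial σ δ} (hg : g ≠ 0) (f : OrePolynomial σ δ) :
    lrem f g = 0 ∨ natDegree (lrem f g) < natDegree g :=
  (divLoop_spec hg (natDegree f + 1) 0 f (Or.inr (by omega))).2

theorem lquot_mul_right {g : OrePolynomial σ δ} (hg : g ≠ 0) (c : OrePolynomial σ δ) :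
    lquot (c * g) g = c := by
  have h := lquot_mul_add_lrem hg (c * g)
  by_contra hne
  have hs : c - lquot (c * g) g ≠ 0 := sub_ne_zero.2 fun h => hne h.symm
  have h1 : lrem (c * g) g = (c - lquot (c * g) g) * g := by
    -- A wrong quotient makes the remainder a nonzero left multiple of `g`, whose degree is too
    -- large.
    rw [sub_mul, eq_sub_iff_add_eq, add_comm, h]
  rcases lrem_degree hg (c * g) with h2 | h2
  · exact mul_ne_zero hs hg (h1.symm.trans h2)
  · rw [h1, natDegree_mul hs hg] at h2
    omega

theorem lquot_mul_cancel {f g : OrePolynomial σ δ} (hg : g ≠ 0) (h : f ∈ Ideal.span {g}) :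
    lquot f g * g = f := by
  obtain ⟨c, rfl⟩ := Ideal.mem_span_singleton'.1 h
  rw [lquot_mul_right hg]

/-- The left ideal `R f₀ + R f₁` is invariant under a Euclidean step. The hypothesis says that
enough passes remain: with none left it forces `f₁ = 0`. -/
theorem rgdLoop_spec (n : ℕ) (f₀ f₁ : OrePolynomial σ δ) (h : f₁ = 0 ∨ natDegree f₁ < n) :
    Ideal.span {rgdLoop n f₀ f₁} = Ideal.span {f₀} ⊔ Ideal.span {f₁} := by
  induction n generalizing f₀ f₁ with
  | zero =>
    have h0 : f₁ = 0 := by simpa using h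
    rw [rgdLoop, h0]
    simp
  | succ n ih =>
    rw [rgdLoop]
    split_ifs with h0
    · rw [h0]; simp
    · rw [ih]
      · have h1 := lquot_mul_add_lrem h0 f₀
        apply le_antisymm <;> rw [sup_le_iff] <;> constructor <;>
          rw [Ideal.span_singleton_le_iff_mem]
        · exact Ideal.mem_sup_right (Ideal.mem_span_singleton_self _)
        · rw [← eq_sub_iff_add_eq'] at h1
          rw [h1]
          exact sub_mem (Ideal.mem_sup_left (Ideal.mem_span_singleton_self _))
            (Ideal.mem_sup_right (Ideal.mem_span_singleton'.2 ⟨_, rfl⟩))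
        · have h2 := add_mem
            (Ideal.mem_sup_left (T := Ideal.span {lrem f₀ f₁})
              (Ideal.mem_span_singleton'.2 ⟨lquot f₀ f₁, rfl⟩ : _ ∈ Ideal.span {f₁}))
            (Ideal.mem_sup_right (Ideal.mem_span_singleton_self _))
          rwa [h1] at h2
        · exact Ideal.mem_sup_left (Ideal.mem_span_singleton_self _)
      · rcases lrem_degree h0 f₀ with h1 | h1
        · exact Or.inl h1
        · exact Or.inr (by have := h.resolve_left h0; omega)

/-- `(f, g)_r` generates `R f + R g`. -/
theorem span_rgd (f g : OrePolynomial σ δ) :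
    Ideal.span {rgd f g} = Ideal.span {f} ⊔ Ideal.span {g} :=
  rgdLoop_spec _ f g (Or.inr (by omega))

end

end OrePolynomial

/-! ### Regularity of semisimple rings and zero divisors of corners -/

theorem IsSemisimpleRing.exists_mul_mul_eq_self {A : Type*} [Ring A] [IsSemisimpleRing A] (x : A) :
    ∃ y : A, x * y * x = x := by
  obtain ⟨e, he, h⟩ := IsSemisimpleRing.ideal_eq_span_idempotent (Ideal.span {x})
  obtain ⟨y, hy⟩ := Ideal.mem_span_singleton'.1 (h ▸ Ideal.mem_span_singleton_self e)
  obtain ⟨z, hz⟩ := Ideal.mem_span_singleton'.1 (h ▸ Ideal.mem_span_singleton_self x)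
  refine ⟨y, ?_⟩
  -- With `A x = A e`, `y x = e` and `x = z e`, the product is `x e = z e e = x`.
  rw [mul_assoc, hy, ← hz, mul_assoc, he.eq]

/-- In a semisimple ring, a left ideal strictly between `A e` and `A` yields a zero divisor of
`(1 - e) A (1 - e)`. -/
theorem OrePolynomial.exists_isCornerZeroDivisor {A : Type*} [Ring A] [IsSemisimpleRing A]
    {e b : A} (he : IsIdempotentElem e) (heb : e ∈ Ideal.span {b}) (hbe : b ∉ Ideal.span {e})
    (hb : Ideal.span {b} ≠ ⊤) : ∃ x, OrePolynomial.IsCornerZeroDivisor e x := by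
  obtain ⟨u, hu, h⟩ := IsSemisimpleRing.ideal_eq_span_idempotent (Ideal.span {b * (1 - e)})
  obtain ⟨c, hc⟩ := Ideal.mem_span_singleton'.1 (h ▸ Ideal.mem_span_singleton_self u)
  obtain ⟨d, hd⟩ := Ideal.mem_span_singleton'.1 (h ▸ Ideal.mem_span_singleton_self (b * (1 - e)))
  have h0 : (1 - e) * e = 0 := by rw [sub_mul, one_mul, he.eq, sub_self]
  have hue : u * e = 0 := by rw [← hc, mul_assoc, mul_assoc, h0, mul_zero, mul_zero]
  have hue' : u * (1 - e) = u := by rw [mul_sub, mul_one, hue, sub_zero]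
  have hxx : (1 - e) * u * ((1 - e) * u) = (1 - e) * u := by
    rw [mul_assoc, ← mul_assoc u, hue', hu.eq]
  -- Here `u` is an idempotent generator of `A b (1 - e)`. The zero divisor is the idempotent `(1 -
  -- e) u` of the corner, and its partner is the complementary idempotent. The first is nonzero
  -- because `b ∉ A e`, the second because `A b ≠ A`.
  refine ⟨(1 - e) * u, ⟨u, by rw [mul_assoc, hue']⟩, fun hx => ?_, (1 - e) - (1 - e) * u,
    ⟨1 - u, ?_⟩, fun hy => ?_, Or.inl ?_⟩
  · have h1 : u = e * u := by rwa [sub_mul, one_mul, sub_eq_zero] at hx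
    have h2 : u = 0 := by rw [← hu.eq]; nth_rw 2 [h1]; rw [← mul_assoc, hue, zero_mul]
    rw [h2, mul_zero] at hd
    refine hbe (Ideal.mem_span_singleton'.2 ⟨b, ?_⟩)
    rw [mul_sub, mul_one, eq_comm, sub_eq_zero] at hd
    exact hd.symm
  · rw [mul_assoc (1 - e), sub_mul 1 u, hue', one_mul, mul_sub, he.one_sub.eq]
  · apply hb
    rw [Ideal.eq_top_iff_one]
    obtain ⟨k, hk⟩ := Ideal.mem_span_singleton'.1 heb
    have h1 : 1 = e + (1 - e) * c * (b - b * e) := by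
      have : (1 - e) * c * (b - b * e) = (1 - e) * u := by
        rw [← hc, mul_sub b, mul_one, mul_assoc]
      rw [this, ← sub_eq_zero.1 hy]
      abel
    rw [h1]
    have hbb := Ideal.mem_span_singleton_self b
    exact add_mem heb (Ideal.mul_mem_left _ _ (sub_mem hbb (Ideal.mul_mem_left _ _ heb)))
  · rw [mul_sub, hxx, mul_assoc, hue', sub_self]

theorem mul_eq_one_symm_of_isNoetherianRing {A : Type*} [Ring A] [IsNoetherianRing A] {u x : A}
    (h : u * x = 1) : x * u = 1 := by
  -- Right multiplication by `x` is surjective, hence injective, and it sends both `x u` and `1` to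
  -- `x`.
  have hinj := IsNoetherian.injective_of_surjective_endomorphism
    (LinearMap.toSpanSingleton A A x) fun r => ⟨r * u, by simp [mul_assoc, h]⟩
  apply hinj
  simp [mul_assoc, h]

/-- A zero divisor of `(1 - e) A (1 - e)` does not generate the left ideal `A (1 - e)`. -/
theorem OrePolynomial.IsCornerZeroDivisor.mul_ne {A : Type*} [Ring A] [IsNoetherianRing A]
    {e x : A} (he : IsIdempotentElem e) (hx : OrePolynomial.IsCornerZeroDivisor e x) (a : A) :
    a * x ≠ 1 - e := by
  intro ha
  obtain ⟨⟨x', hx'⟩, -, y, ⟨y', hy'⟩, hy0, hxy⟩ := hx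
  have h0 : (1 - e) * e = 0 := by rw [sub_mul, one_mul, he.eq, sub_self]
  have h0' : e * (1 - e) = 0 := by rw [mul_sub, mul_one, he.eq, sub_self]
  have h1 := he.one_sub.eq
  have hex : e * x = 0 := by rw [hx', ← mul_assoc, ← mul_assoc, h0', zero_mul, zero_mul]
  have hxe : x * e = 0 := by rw [hx', mul_assoc, h0, mul_zero]
  have hx1 : (1 - e) * x = x := by rw [sub_mul, one_mul, hex, sub_zero]
  have hy1 : (1 - e) * y = y := by rw [hy', ← mul_assoc, ← mul_assoc, h1]
  have hy2 : y * (1 - e) = y := by rw [hy', mul_assoc, h1]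
  rcases hxy with h | h
  · apply hy0
    rw [← hy1, ← ha, mul_assoc, h, mul_zero]
  -- If `y x = 0`, adding `e` extends the left inverse of `x` in the corner to a left inverse of `x
  -- + e` in `A`. It is two-sided, while `y (x + e) = 0`.
  · have h2 : ((1 - e) * a * (1 - e) + e) * (x + e) = 1 := by
      have h3 : (1 - e) * a * (1 - e) * x = 1 - e := by
        rw [mul_assoc, hx1, mul_assoc, ha, h1]
      have h4 : (1 - e) * a * (1 - e) * e = 0 := by rw [mul_assoc, h0, mul_zero]
      rw [add_mul, mul_add, mul_add, h3, h4, hex, he.eq]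
      abel
    have h3 := mul_eq_one_symm_of_isNoetherianRing h2
    apply hy0
    have hye : y * e = 0 := by rw [← hy2, mul_assoc, h0, mul_zero]
    have : y * ((x + e) * ((1 - e) * a * (1 - e) + e)) = 0 := by
      rw [← mul_assoc, mul_add y, h, hye, add_zero, zero_mul]
    rwa [h3, mul_one] at this

/-! ### Matrix rings and simple quotients -/

/-- A proper left ideal of an `n × n` matrix ring over a division ring has `n` translates whose
intersection vanishes. -/
theorem Matrix.exists_forall_mul_mem_imp_eq_zero {A E : Type*} [Ring A] [DivisionRing E] {n : ℕ}
    (φ : A ≃+* Matrix (Fin n) (Fin n) E) {I : Ideal A} (hI : I ≠ ⊤) :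
    ∃ c : Fin n → A, ∀ a, (∀ j, a * c j ∈ I) → a = 0 := by
  obtain ⟨i, hi⟩ : ∃ i, φ.symm (Matrix.single i i 1) ∉ I := by
    by_contra! h
    apply hI
    rw [Ideal.eq_top_iff_one, ← map_one φ.symm, ← Matrix.sum_single_one, map_sum]
    exact sum_mem fun i _ => h i
  -- The ideal misses some matrix unit `Eᵢᵢ`, and the translates are by the `Eⱼᵢ`. If `a` has a
  -- nonzero entry at `(k, j)`, a left multiple of `a Eⱼᵢ` equals `Eᵢᵢ`.
  refine ⟨fun j => φ.symm (Matrix.single j i 1), fun a ha => ?_⟩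
  by_contra h0
  obtain ⟨k, j, hkj⟩ : ∃ k j, φ a k j ≠ 0 := by
    by_contra! h
    exact h0 ((map_eq_zero_iff φ φ.injective).1 (Matrix.ext h))
  apply hi
  have : φ.symm (Matrix.single i i 1) =
      φ.symm (Matrix.single i k (φ a k j)⁻¹) * (a * φ.symm (Matrix.single j i 1)) := by
    apply φ.injective
    simp only [map_mul, RingEquiv.apply_symm_apply]
    rw [← mul_assoc, Matrix.single_mul_mul_single]
    simp [inv_mul_cancel₀ hkj]
  rw [this]
  exact Ideal.mul_mem_left _ _ (ha j)

universe u

theorem IsSimpleRing.exists_ringEquiv_matrix_mul_self_le_finrank (F : Type*) {A : Type u} [Field F]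
    [Ring A] [Algebra F A] [IsSimpleRing A] [Module.Finite F A] :
    ∃ (n : ℕ) (E : Type u) (_ : DivisionRing E),
      Nonempty (A ≃+* Matrix (Fin n) (Fin n) E) ∧ n * n ≤ Module.finrank F A := by
  have : IsArtinianRing A := IsArtinianRing.of_finite F A
  obtain ⟨n, -, E, _, _, _, ⟨φ⟩⟩ := exists_algEquiv_matrix_divisionRing_finite F A
  refine ⟨n, E, inferInstance, ⟨φ.toRingEquiv⟩, ?_⟩
  -- The dimension is `n * n` times the dimension of `E`, which is positive.
  rw [φ.toLinearEquiv.finrank_eq, Module.finrank_matrix, Fintype.card_fin]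
  exact Nat.le_mul_of_pos_right _ Module.finrank_pos

/-- A simple quotient of a ring which is free of rank `r` over its center is Artinian, and it is a
matrix ring of size at most `√r`. -/
theorem IsSimpleRing.exists_ringEquiv_matrix_of_center {R : Type*} {A : Type u} [Ring R] [Nontrivial R]
    [Module.Free (Subring.center R) R] [Module.Finite (Subring.center R) R] [Ring A]
    [IsSimpleRing A] (φ : R →+* A) (hφ : Function.Surjective φ) :
    IsArtinianRing A ∧ ∃ (n : ℕ) (E : Type u) (_ : DivisionRing E),
      Nonempty (A ≃+* Matrix (Fin n) (Fin n) E) ∧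
        n * n ≤ Module.finrank (Subring.center R) R := by
  let _ : Field (Subring.center A) := (isField_center A).toField
  let b := Module.Free.chooseBasis (Subring.center R) R
  -- A surjection maps center into center, so the image of a basis of `R` over its center spans `A`
  -- over the center of `A`.
  have htop : Submodule.span (Subring.center A) (Set.range (φ ∘ b)) = ⊤ := by
    rw [eq_top_iff]
    rintro x -
    obtain ⟨y, rfl⟩ := hφ x
    rw [← b.sum_repr y, map_sum]
    refine sum_mem fun i _ => ?_
    have hc : φ (b.repr y i : R) ∈ Subring.center A := by
      rw [Subring.mem_center_iff]
      intro x
      obtain ⟨z, rfl⟩ := hφ x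
      rw [← map_mul, ← map_mul, Subring.mem_center_iff.1 (b.repr y i).2 z]
    have : φ (b.repr y i • b i) = (⟨_, hc⟩ : Subring.center A) • φ (b i) := by
      rw [Subring.smul_def, smul_eq_mul, map_mul]
      rfl
    rw [this]
    exact Submodule.smul_mem _ _ (Submodule.subset_span ⟨i, rfl⟩)
  have hfin : Module.Finite (Subring.center A) A :=
    ⟨htop ▸ Submodule.fg_span (Set.finite_range _)⟩
  refine ⟨IsArtinianRing.of_finite (Subring.center A) A, ?_⟩
  obtain ⟨n, E, _, h, hn⟩ := exists_ringEquiv_matrix_mul_self_le_finrank (Subring.center A) (A := A)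
  refine ⟨n, E, inferInstance, h, hn.trans ?_⟩
  have h1 := finrank_range_le_card (R := Subring.center A) (φ ∘ b)
  rw [Set.finrank, htop, finrank_top] at h1
  rwa [Module.finrank_eq_card_chooseBasisIndex (Subring.center R) R]

namespace OrePolynomial

noncomputable section

open Classical

variable {D : Type*} [DivisionRing D] {σ : D ≃+* D} {δ : SkewDerivation σ}

/-! ### Twosided polynomials and the quotients `R / R π` -/

theorem IsTwosided.exists_mul_left {a : OrePolynomial σ δ} (ha : IsTwosided a)
    (r : OrePolynomial σ δ) : ∃ s, a * r = s * a := by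
  obtain ⟨s, hs⟩ : a * r ∈ Set.range (fun r : OrePolynomial σ δ => r * a) := ha ▸ ⟨r, rfl⟩
  exact ⟨s, hs.symm⟩

theorem IsTwosided.exists_mul_right {a : OrePolynomial σ δ} (ha : IsTwosided a)
    (r : OrePolynomial σ δ) : ∃ s, r * a = a * s := by
  obtain ⟨s, hs⟩ : r * a ∈ Set.range (fun r : OrePolynomial σ δ => a * r) := ha ▸ ⟨r, rfl⟩
  exact ⟨s, hs.symm⟩

theorem IsTwosided.mul_mem {a : OrePolynomial σ δ} (ha : IsTwosided a)
    {I : Ideal (OrePolynomial σ δ)} (h : a ∈ I) (r : OrePolynomial σ δ) : a * r ∈ I := by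
  obtain ⟨s, hs⟩ := ha.exists_mul_left r
  exact hs ▸ I.mul_mem_left s h

theorem IsTwosided.of_exists {a : OrePolynomial σ δ} (h₁ : ∀ r, ∃ s, a * r = s * a)
    (h₂ : ∀ r, ∃ s, r * a = a * s) : IsTwosided a := by
  apply Set.Subset.antisymm
  · rintro _ ⟨r, rfl⟩
    obtain ⟨s, hs⟩ := h₂ r
    exact ⟨s, hs.symm⟩
  · rintro _ ⟨r, rfl⟩
    obtain ⟨s, hs⟩ := h₁ r
    exact ⟨s, hs.symm⟩

theorem IsTwosided.mul {a b : OrePolynomial σ δ} (ha : IsTwosided a) (hb : IsTwosided b) :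
    IsTwosided (a * b) := by
  refine .of_exists (fun r => ?_) fun r => ?_
  · obtain ⟨s, hs⟩ := hb.exists_mul_left r
    obtain ⟨t, ht⟩ := ha.exists_mul_left s
    exact ⟨t, by rw [mul_assoc, hs, ← mul_assoc, ht, mul_assoc]⟩
  · obtain ⟨s, hs⟩ := ha.exists_mul_right r
    obtain ⟨t, ht⟩ := hb.exists_mul_right s
    exact ⟨t, by rw [← mul_assoc, hs, mul_assoc, ht, mul_assoc]⟩

theorem isTwosided_of_mem_center {a : OrePolynomial σ δ}
    (ha : a ∈ Subring.center (OrePolynomial σ δ)) : IsTwosided a := by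
  rw [Subring.mem_center_iff] at ha
  exact .of_exists (fun r => ⟨r, (ha r).symm⟩) fun r => ⟨r, ha r⟩

theorem isTwosided_list_prod {l : List (OrePolynomial σ δ)} (h : ∀ a ∈ l, IsTwosided a) :
    IsTwosided l.prod := by
  induction l with
  | nil => exact isTwosided_of_mem_center (one_mem _)
  | cons a l ih =>
    rw [List.prod_cons]
    exact (h a (by simp)).mul (ih fun b hb => h b (by simp [hb]))

theorem toQuo_surjective (π : OrePolynomial σ δ) : Function.Surjective (toQuo π) :=
  RingCon.mk'_surjective _

theorem toQuo_eq_zero_iff_mem_span {π f : OrePolynomial σ δ} :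
    toQuo π f = 0 ↔ f ∈ TwoSidedIdeal.span {π} := by
  rw [← TwoSidedIdeal.mem_ker]
  exact iff_of_eq (congrArg (f ∈ ·) (TwoSidedIdeal.ker_ringCon_mk' _))

theorem toQuo_eq_zero_iff {π f : OrePolynomial σ δ} (hπ : IsTwosided π) :
    toQuo π f = 0 ↔ f ∈ Ideal.span {π} := by
  rw [toQuo_eq_zero_iff_mem_span]
  constructor
  · intro h
    have : (Ideal.span {π}).IsTwoSided := ⟨fun {x} r hx => by
      obtain ⟨c, rfl⟩ := Ideal.mem_span_singleton'.1 hx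
      rw [mul_assoc]
      exact Ideal.mul_mem_left _ _ (hπ.mul_mem (Ideal.mem_span_singleton_self π) r)⟩
    have h1 : TwoSidedIdeal.span {π} ≤ (Ideal.span {π}).toTwoSided := by
      rw [TwoSidedIdeal.span_le, Set.singleton_subset_iff, SetLike.mem_coe, Ideal.mem_toTwoSided]
      exact Ideal.mem_span_singleton_self π
    exact Ideal.mem_toTwoSided.1 (h1 h)
  · intro h
    obtain ⟨c, rfl⟩ := Ideal.mem_span_singleton'.1 h
    exact TwoSidedIdeal.mul_mem_left _ _ _ (TwoSidedIdeal.subset_span rfl)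

/-- Since `R π ⊆ R g`, nothing is lost modulo `π`. This transfers statements about right divisors of
`π` to left ideals of `R / R π` and back. -/
theorem toQuo_mem_span {π f g : OrePolynomial σ δ} (hπ : IsTwosided π)
    (h : π ∈ Ideal.span {g}) : toQuo π f ∈ Ideal.span {toQuo π g} ↔ f ∈ Ideal.span {g} := by
  constructor
  · intro hf
    obtain ⟨c, hc⟩ := Ideal.mem_span_singleton'.1 hf
    obtain ⟨c, rfl⟩ := toQuo_surjective π c
    rw [← map_mul, eq_comm, ← sub_eq_zero, ← map_sub, toQuo_eq_zero_iff hπ] at hc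
    have h1 := (Ideal.span_singleton_le_iff_mem _).2 h hc
    simpa using add_mem h1 (Ideal.mul_mem_left _ c (Ideal.mem_span_singleton_self g))
  · intro hf
    obtain ⟨c, rfl⟩ := Ideal.mem_span_singleton'.1 hf
    rw [map_mul]
    exact Ideal.mul_mem_left _ _ (Ideal.mem_span_singleton_self _)

theorem span_toQuo_ne_top {π g : OrePolynomial σ δ} (hπ : IsTwosided π) (h : π ∈ Ideal.span {g})
    (hg : ¬IsUnit g) : Ideal.span {toQuo π g} ≠ ⊤ := by
  rw [Ne, Ideal.eq_top_iff_one, ← map_one (toQuo π), toQuo_mem_span hπ h]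
  intro h1
  obtain ⟨c, hc⟩ := Ideal.mem_span_singleton'.1 h1
  exact hg (IsUnit.of_mul_eq_one_right _ hc)

theorem IsPrimeTwosided.ne_zero {π : OrePolynomial σ δ} (hπ : IsPrimeTwosided π) : π ≠ 0 := by
  rintro rfl
  exact hπ.2.1.ne' (Polynomial.natDegree_zero (R := D))

theorem IsPrimeTwosided.isSimpleRing {π : OrePolynomial σ δ} (hπ : IsPrimeTwosided π) :
    IsSimpleRing (Quo π) := by
  have : Nontrivial (Quo π) := by
    refine ⟨1, 0, fun h => hπ.2.2.1 ?_⟩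
    rw [← map_one (toQuo π), toQuo_eq_zero_iff_mem_span] at h
    exact (TwoSidedIdeal.one_mem_iff _).1 h
  refine .of_eq_bot_or_eq_top fun I => ?_
  have hle : TwoSidedIdeal.span {π} ≤ TwoSidedIdeal.comap (toQuo π) I := fun x hx => by
    rw [TwoSidedIdeal.mem_comap, toQuo_eq_zero_iff_mem_span.2 hx]
    exact I.zero_mem
  rcases hπ.2.2.le_iff.1 hle with h | h
  · right
    rw [← TwoSidedIdeal.one_mem_iff, ← map_one (toQuo π), ← TwoSidedIdeal.mem_comap, h]
    exact TwoSidedIdeal.mem_top _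
  · left
    rw [eq_bot_iff]
    intro x hx
    obtain ⟨x, rfl⟩ := toQuo_surjective π x
    rw [TwoSidedIdeal.mem_bot, toQuo_eq_zero_iff_mem_span, ← h, TwoSidedIdeal.mem_comap]
    exact hx

/-! ### Dimension over `D` of the modules `R / R q` -/

/-- `D` as a subring of `D[X;σ,δ]`. -/
def constHom : D →+* OrePolynomial σ δ where
  toFun := const
  map_one' := rfl
  map_mul' a b := (const_mul_const a b).symm
  map_zero' := map_zero (monomial 0)
  map_add' := map_add (monomial 0)

instance : Module D (OrePolynomial σ δ) := Module.compHom _ (constHom (σ := σ) (δ := δ))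

theorem smul_eq (a : D) (f : OrePolynomial σ δ) : a • f = const a * f := rfl

instance : IsScalarTower D (OrePolynomial σ δ) (OrePolynomial σ δ) :=
  ⟨fun a f g => mul_assoc (const a) f g⟩

theorem coeff_smul (a : D) (n : ℕ) (f : OrePolynomial σ δ) : coeff n (a • f) = a * coeff n f := by
  rw [smul_eq, const, monomial_mul]
  exact coeff_lmulConst a n f

theorem coeff_X_pow (n m : ℕ) :
    coeff n (X ^ m : OrePolynomial σ δ) = if m = n then 1 else 0 := by
  rw [← coeff_monomial (σ := σ) (δ := δ), ← const_mul_X_pow, const_one, one_mul]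

theorem coeff_sum_smul_X_pow {N : ℕ} (d : Fin N → D) (n : ℕ) :
    coeff n (∑ i, d i • X ^ (i : ℕ) : OrePolynomial σ δ) =
      if h : n < N then d ⟨n, h⟩ else 0 := by
  simp only [map_sum, coeff_smul, coeff_X_pow]
  split_ifs with h
  · rw [Finset.sum_eq_single ⟨n, h⟩]
    · simp
    · intro i _ hi
      rw [if_neg (fun h => hi (Fin.ext h)), mul_zero]
    · simp
  · exact Finset.sum_eq_zero fun i _ => by rw [if_neg (by omega), mul_zero]

theorem eq_sum_smul_X_pow {f : OrePolynomial σ δ} {N : ℕ} (h : f = 0 ∨ natDegree f < N) :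
    f = ∑ i : Fin N, coeff i f • X ^ (i : ℕ) := by
  apply ext_coeff
  intro n
  rw [coeff_sum_smul_X_pow]
  split_ifs with hn
  · rfl
  · rcases h with rfl | h
    · exact map_zero _
    · exact coeff_eq_zero_of_lt (by omega)

/-- The projection onto `R / R q`, as a map of left `D`-vector spaces. -/
def quotientMap (q : OrePolynomial σ δ) :
    OrePolynomial σ δ →ₗ[D] OrePolynomial σ δ ⧸ (Ideal.span {q}) :=
  (Submodule.mkQ (Ideal.span {q})).restrictScalars D

theorem quotientMap_eq_zero_iff {q f : OrePolynomial σ δ} :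
    quotientMap q f = 0 ↔ f ∈ Ideal.span {q} :=
  Submodule.Quotient.mk_eq_zero _

theorem span_quotientMap_X_pow {q : OrePolynomial σ δ} (hq : q ≠ 0) :
    Submodule.span D (Set.range fun i : Fin (natDegree q) =>
      quotientMap q (X ^ (i : ℕ))) = ⊤ := by
  rw [eq_top_iff]
  rintro x -
  obtain ⟨f, rfl⟩ : ∃ f, quotientMap q f = x := Submodule.mkQ_surjective _ x
  have h1 : quotientMap q f = quotientMap q (lrem f q) := by
    rw [← sub_eq_zero, ← map_sub, quotientMap_eq_zero_iff, Ideal.mem_span_singleton']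
    exact ⟨lquot f q, by rw [eq_sub_iff_add_eq, lquot_mul_add_lrem hq]⟩
  rw [h1, eq_sum_smul_X_pow (lrem_degree hq f), map_sum]
  refine sum_mem fun i _ => ?_
  rw [map_smul]
  exact Submodule.smul_mem _ _ (Submodule.subset_span ⟨i, rfl⟩)

theorem finite_quotient {q : OrePolynomial σ δ} (hq : q ≠ 0) :
    Module.Finite D (OrePolynomial σ δ ⧸ (Ideal.span {q})) :=
  ⟨span_quotientMap_X_pow hq ▸ Submodule.fg_span (Set.finite_range _)⟩

theorem finrank_quotient_le {q : OrePolynomial σ δ} (hq : q ≠ 0) :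
    Module.finrank D (OrePolynomial σ δ ⧸ (Ideal.span {q})) ≤ natDegree q := by
  have h := finrank_range_le_card (R := D) fun i : Fin (natDegree q) => quotientMap q (X ^ (i : ℕ))
  rwa [Set.finrank, span_quotientMap_X_pow hq, finrank_top, Fintype.card_fin] at h

/-- If `R / R π` embeds into `(R / R q)ⁿ`, then `deg π ≤ n deg q`. -/
theorem natDegree_le_mul_of_forall_mul_mem {π q : OrePolynomial σ δ} (hq : q ≠ 0) {n : ℕ}
    (c : Fin n → OrePolynomial σ δ)
    (hc : ∀ a, (∀ j, a * c j ∈ Ideal.span {q}) → a ∈ Ideal.span {π}) :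
    natDegree π ≤ n * natDegree q := by
  have := finite_quotient hq
  -- A vanishing combination of these images of `1, X, X², …` comes from a polynomial in `R π` of
  -- degree below `deg π`, hence from `0`.
  have hv : LinearIndependent D fun (i : Fin (natDegree π)) (j : Fin n) =>
      quotientMap q (X ^ (i : ℕ) * c j) := by
    rw [Fintype.linearIndependent_iff]
    intro d hd i
    have h1 : (∑ i, d i • X ^ (i : ℕ) : OrePolynomial σ δ) ∈ Ideal.span {π} := by
      refine hc _ fun j => ?_
      rw [← quotientMap_eq_zero_iff, Finset.sum_mul, map_sum]
      have := congrFun hd j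
      rw [Finset.sum_apply] at this
      simp only [smul_mul_assoc, map_smul]
      exact this
    obtain ⟨b, hb⟩ := Ideal.mem_span_singleton'.1 h1
    have h2 : (∑ i, d i • X ^ (i : ℕ) : OrePolynomial σ δ) = 0 := by
      by_contra h0
      have hb0 : b ≠ 0 := by rintro rfl; exact h0 (by rw [← hb, zero_mul])
      have hπ0 : π ≠ 0 := by rintro rfl; exact h0 (by rw [← hb, mul_zero])
      have h3 := coeff_mul_top_ne_zero hb0 hπ0
      rw [hb, coeff_sum_smul_X_pow, dif_neg (by omega)] at h3
      exact h3 rfl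
    have h3 := coeff_sum_smul_X_pow (σ := σ) (δ := δ) d i
    rw [h2, map_zero, dif_pos i.2] at h3
    exact h3.symm
  have h := hv.fintype_card_le_finrank
  rw [Fintype.card_fin, Module.finrank_pi_fintype, Finset.sum_const, Finset.card_univ,
    Fintype.card_fin, smul_eq_mul] at h
  exact h.trans (Nat.mul_le_mul_left _ (finrank_quotient_le hq))

end

/-! ### The degree bound for right divisors of a prime twosided polynomial -/

section

variable {D : Type*} [DivisionRing D] {σ : D ≃+* D} {δ : SkewDerivation σ}

theorem IsPrimeTwosided.isArtinianRing [Module.Free (Subring.center (OrePolynomial σ δ))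
    (OrePolynomial σ δ)] [Module.Finite (Subring.center (OrePolynomial σ δ)) (OrePolynomial σ δ)]
    {π : OrePolynomial σ δ} (hπ : IsPrimeTwosided π) : IsArtinianRing (Quo π) :=
  have := hπ.isSimpleRing
  (IsSimpleRing.exists_ringEquiv_matrix_of_center (toQuo π) (toQuo_surjective π)).1

/-- A nonconstant right divisor of a prime twosided polynomial `π` has degree at least
`deg π / √r`. -/
theorem IsPrimeTwosided.natDegree_le_sqrt_mul [Module.Free (Subring.center (OrePolynomial σ δ))
    (OrePolynomial σ δ)] [Module.Finite (Subring.center (OrePolynomial σ δ)) (OrePolynomial σ δ)]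
    {π q : OrePolynomial σ δ} (hπ : IsPrimeTwosided π) (hπq : π ∈ Ideal.span {q})
    (hq : ¬IsUnit q) :
    (natDegree π : ℝ) ≤
      √(Module.finrank (Subring.center (OrePolynomial σ δ)) (OrePolynomial σ δ) : ℝ)
        * natDegree q := by
  have := hπ.isSimpleRing
  obtain ⟨-, n, E, _, ⟨φ⟩, hn⟩ :=
    IsSimpleRing.exists_ringEquiv_matrix_of_center (toQuo π) (toQuo_surjective π)
  obtain ⟨c, hc⟩ := Matrix.exists_forall_mul_mem_imp_eq_zero φ (span_toQuo_ne_top hπ.1 hπq hq)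
  choose c' hc' using fun j => toQuo_surjective π (c j)
  have hq0 : q ≠ 0 := by
    rintro rfl
    exact hπ.ne_zero (by simpa using hπq)
  have h := natDegree_le_mul_of_forall_mul_mem (π := π) hq0 c' fun a ha => by
    rw [← toQuo_eq_zero_iff hπ.1]
    refine hc _ fun j => ?_
    rw [← hc', ← map_mul, toQuo_mem_span hπ.1 hπq]
    exact ha j
  calc (natDegree π : ℝ) ≤ n * natDegree q := by exact_mod_cast h
    _ ≤ _ := by
      gcongr
      apply Real.le_sqrt_of_sq_le
      rw [sq]
      exact_mod_cast hn

end

end OrePolynomial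

/-! ### Correctness of `FactorizeIrred` -/

namespace OrePolynomial

open Classical

variable {D : Type*} [DivisionRing D] {σ : D ≃+* D} {δ : SkewDerivation σ}

theorem irreducible_of_not_exists_mul {f : OrePolynomial σ δ} (hf : ¬IsUnit f)
    (h : ∀ a b, f = a * b → ¬IsUnit a → ¬IsUnit b → False) : Irreducible f :=
  ⟨hf, fun {a b} hab => by
    by_contra! hne
    exact h a b hab hne.1 hne.2⟩

theorem ne_zero_of_mem_span {f g : OrePolynomial σ δ} (hf : f ≠ 0) (h : f ∈ Ideal.span {g}) :
    g ≠ 0 := by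
  rintro rfl
  exact hf (by simpa using h)

theorem mem_span_of_mul_mem_span {a f g : OrePolynomial σ δ} (hg : g ≠ 0)
    (h : a * g ∈ Ideal.span {f * g}) : a ∈ Ideal.span {f} := by
  obtain ⟨c, hc⟩ := Ideal.mem_span_singleton'.1 h
  rw [← mul_assoc] at hc
  exact Ideal.mem_span_singleton'.2 ⟨c, mul_right_cancel₀ hg hc⟩

section

variable [Module.Free (Subring.center (OrePolynomial σ δ)) (OrePolynomial σ δ)]
  [Module.Finite (Subring.center (OrePolynomial σ δ)) (OrePolynomial σ δ)]

/-- A proper right factor of `f` would be a nonconstant right divisor of `π` with degree below the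
minimum allowed by `natDegree_le_sqrt_mul`. -/
theorem irreducible_of_natDegree_eq_sqrt_mul {π f : OrePolynomial σ δ} (hπ : IsPrimeTwosided π)
    (hπf : π ∈ Ideal.span {f}) (hf : ¬IsUnit f) (h : (natDegree π : ℝ) =
      √(Module.finrank (Subring.center (OrePolynomial σ δ)) (OrePolynomial σ δ) : ℝ)
        * natDegree f) : Irreducible f := by
  have hf0 := ne_zero_of_mem_span hπ.ne_zero hπf
  refine irreducible_of_not_exists_mul hf fun a b hab ha hb => ?_
  have ha0 : a ≠ 0 := by rintro rfl; exact hf0 (by rw [hab, zero_mul])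
  have hb0 : b ≠ 0 := by rintro rfl; exact hf0 (by rw [hab, mul_zero])
  have hfb : f ∈ Ideal.span {b} := Ideal.mem_span_singleton'.2 ⟨a, hab.symm⟩
  have h1 := hπ.natDegree_le_sqrt_mul ((Ideal.span_singleton_le_iff_mem _).2 hfb hπf) hb
  rw [h] at h1
  have h2 : natDegree b < natDegree f := by
    rw [hab, natDegree_mul ha0 hb0]
    have := natDegree_pos_of_not_isUnit ha0 ha
    omega
  have h3 : 0 < √(Module.finrank (Subring.center (OrePolynomial σ δ)) (OrePolynomial σ δ) : ℝ) :=
    Real.sqrt_pos.2 (by exact_mod_cast Module.finrank_pos)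
  have h4 : (natDegree f : ℝ) ≤ natDegree b := le_of_mul_le_mul_left h1 h3
  exact absurd (by exact_mod_cast h4 : natDegree f ≤ natDegree b) (by omega)

/-- The ring `R / R π` is simple Artinian, hence regular, so a solution `y` exists. In the form `f e
= f` with `e = y f`, the equation shows that `e` and `f` generate the same left ideal. -/
theorem Subroutines.Correct.mul_solve_mul {S : Subroutines σ δ} (hS : S.Correct)
    {π : OrePolynomial σ δ} (hπ : IsPrimeTwosided π) (f : OrePolynomial σ δ) :
    toQuo π f * toQuo π (S.solve π f * f) = toQuo π f := by
  have := hπ.isSimpleRing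
  have := hπ.isArtinianRing
  rw [map_mul, ← mul_assoc]
  exact hS.solve_spec π f hπ (IsSemisimpleRing.exists_mul_mul_eq_self _)

theorem Subroutines.Correct.isIdempotentElem_solve_mul {S : Subroutines σ δ} (hS : S.Correct)
    {π : OrePolynomial σ δ} (hπ : IsPrimeTwosided π) (f : OrePolynomial σ δ) :
    IsIdempotentElem (toQuo π (S.solve π f * f)) := by
  have h := hS.mul_solve_mul hπ f
  rw [IsIdempotentElem]
  nth_rw 1 [map_mul]
  rw [mul_assoc, h, ← map_mul]

/-- A factorization `f = a b` into nonunits places `A b` strictly between `A e = A f` and `A`. The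
corner then has a zero divisor, and the subroutine could not have returned `0`. -/
theorem irreducible_of_findZeroDivisor_eq_zero {S : Subroutines σ δ} (hS : S.Correct)
    {π f : OrePolynomial σ δ} (hπ : IsPrimeTwosided π) (hπf : π ∈ Ideal.span {f}) (hf : ¬IsUnit f)
    (h : toQuo π (S.findZeroDivisor π (S.solve π f * f)) = 0) : Irreducible f := by
  have := hπ.isSimpleRing
  have := hπ.isArtinianRing
  have he := hS.isIdempotentElem_solve_mul hπ f
  have hf0 := ne_zero_of_mem_span hπ.ne_zero hπf
  refine irreducible_of_not_exists_mul hf fun a b hab ha hb => ?_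
  have hb0 : b ≠ 0 := by rintro rfl; exact hf0 (by rw [hab, mul_zero])
  have hfb : f ∈ Ideal.span {b} := Ideal.mem_span_singleton'.2 ⟨a, hab.symm⟩
  have hπb := (Ideal.span_singleton_le_iff_mem _).2 hfb hπf
  have hex : ∃ x, IsCornerZeroDivisor (toQuo π (S.solve π f * f)) x := by
    refine exists_isCornerZeroDivisor (b := toQuo π b) he ?_ ?_ (span_toQuo_ne_top hπ.1 hπb hb)
    · rw [toQuo_mem_span hπ.1 hπb]
      exact Ideal.mul_mem_left _ _ hfb
    · intro hmem
      have h1 : toQuo π b ∈ Ideal.span {toQuo π f} := by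
        refine (Ideal.span_singleton_le_iff_mem _).2 ?_ hmem
        rw [map_mul]
        exact Ideal.mul_mem_left _ _ (Ideal.mem_span_singleton_self _)
      rw [toQuo_mem_span hπ.1 hπf] at h1
      obtain ⟨c, hc⟩ := Ideal.mem_span_singleton'.1 h1
      rw [hab, ← mul_assoc] at hc
      have : c * a = 1 := mul_right_cancel₀ hb0 (by rw [hc, one_mul])
      exact ha (IsUnit.of_mul_eq_one_right _ this)
  exact (hS.findZeroDivisor_spec π _ hπ he hex).2.1 h

/-- The two factors found from a zero divisor are proper. -/
theorem rgd_findZeroDivisor_spec {S : Subroutines σ δ} (hS : S.Correct)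
    {π f : OrePolynomial σ δ} (hπ : IsPrimeTwosided π)
    (h : toQuo π (S.findZeroDivisor π (S.solve π f * f)) ≠ 0) :
    ¬IsUnit (rgd (S.findZeroDivisor π (S.solve π f * f)) f) ∧
      rgd (S.findZeroDivisor π (S.solve π f * f)) f ∉ Ideal.span {f} := by
  have := hπ.isSimpleRing
  have := hπ.isArtinianRing
  have he := hS.isIdempotentElem_solve_mul hπ f
  have hfe := hS.mul_solve_mul hπ f
  set e := S.solve π f * f with hedef
  have hx : IsCornerZeroDivisor (toQuo π e) (toQuo π (S.findZeroDivisor π e)) := by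
    refine hS.findZeroDivisor_spec π _ hπ he ?_
    by_contra hne
    exact h (hS.findZeroDivisor_zero π _ hπ he hne)
  set x := S.findZeroDivisor π e with hxdef
  have hxe : toQuo π x * toQuo π e = 0 := by
    obtain ⟨a, ha⟩ := hx.1
    rw [ha, mul_assoc, sub_mul 1 _ (toQuo π e), one_mul, he.eq, sub_self, mul_zero]
  have hspan := span_rgd x f
  constructor
  · intro hu
    have h1 : (1 : OrePolynomial σ δ) ∈ Ideal.span {x} ⊔ Ideal.span {f} := by
      rw [← hspan, Ideal.mem_span_singleton']
      exact hu.exists_left_inv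
    obtain ⟨u, hu, v, hv, huv⟩ := Submodule.mem_sup.1 h1
    obtain ⟨a, rfl⟩ := Ideal.mem_span_singleton'.1 hu
    obtain ⟨b, rfl⟩ := Ideal.mem_span_singleton'.1 hv
    -- Multiply `a x + b f = 1` by `1 - e` on the right: `x (1 - e) = x` and `f (1 - e) = 0` in `A`,
    -- so `a x = 1 - e`.
    refine hx.mul_ne he (toQuo π a) ?_
    have h2 := congrArg (fun w => toQuo π w * (1 - toQuo π e)) huv
    simp only [map_add, map_mul, map_one, one_mul] at h2
    rw [← h2, add_mul, mul_assoc, mul_sub, mul_one, hxe, sub_zero, mul_assoc, mul_sub, mul_one, hfe,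
      sub_self, mul_zero, add_zero]
  · intro hmem
    have hxf : x ∈ Ideal.span {f} := by
      refine (Ideal.span_singleton_le_iff_mem _).2 hmem ?_
      rw [hspan]
      exact Ideal.mem_sup_left (Ideal.mem_span_singleton_self x)
    obtain ⟨c, hc⟩ := Ideal.mem_span_singleton'.1 hxf
    apply hx.2.1
    -- If `x = c f`, then in `A` we get `x = c f e = x e = 0`.
    rw [← hc, map_mul, ← hfe, ← mul_assoc, ← map_mul, hc, hxe]

/-- `FactorizeIrred` factors every nonconstant right divisor of a prime twosided polynomial. -/
theorem exists_factorizeIrred {S : Subroutines σ δ} (hS : S.Correct) {π : OrePolynomial σ δ}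
    (hπ : IsPrimeTwosided π) {f : OrePolynomial σ δ} (hπf : π ∈ Ideal.span {f}) (hf : ¬IsUnit f) :
    ∃ out : List (OrePolynomial σ δ), (∀ n ≥ natDegree f, factorizeIrred S n f π = some out) ∧
      (∀ p ∈ out, Irreducible p) ∧ out.prod = f := by
  -- Both factors have strictly smaller degree, so depth `deg f` is enough; a leaf needs one pass,
  -- and `deg f ≥ 1`.
  induction hd : natDegree f using Nat.strong_induction_on generalizing f with
  | _ d ih =>
  have hf0 := ne_zero_of_mem_span hπ.ne_zero hπf
  have hfpos := natDegree_pos_of_not_isUnit hf0 hf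
  have hf1 : f ≠ 1 := by rintro rfl; exact hf isUnit_one
  by_cases hsqrt : (natDegree π : ℝ) =
      √(Module.finrank (Subring.center (OrePolynomial σ δ)) (OrePolynomial σ δ) : ℝ)
        * natDegree f
  · refine ⟨[f], fun n hn => ?_, ?_, by simp⟩
    · obtain ⟨n, rfl⟩ : ∃ k, n = k + 1 := ⟨n - 1, by omega⟩
      rw [factorizeIrred, if_neg hf1, if_pos hsqrt]
    · simpa using irreducible_of_natDegree_eq_sqrt_mul hπ hπf hf hsqrt
  by_cases haux : toQuo π (S.findZeroDivisor π (S.solve π f * f)) = 0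
  · refine ⟨[f], fun n hn => ?_, ?_, by simp⟩
    · obtain ⟨n, rfl⟩ : ∃ k, n = k + 1 := ⟨n - 1, by omega⟩
      simp only [factorizeIrred, if_neg hf1, if_neg hsqrt, if_pos haux]
    · simpa using irreducible_of_findZeroDivisor_eq_zero hS hπ hπf hf haux
  obtain ⟨hgu, hgf⟩ := rgd_findZeroDivisor_spec hS hπ haux
  have hspan := span_rgd (S.findZeroDivisor π (S.solve π f * f)) f
  set g := rgd (S.findZeroDivisor π (S.solve π f * f)) f with hg
  set h := lquot f g with hh
  have hfg : f ∈ Ideal.span {g} := hspan ▸ Ideal.mem_sup_right (Ideal.mem_span_singleton_self f)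
  have hg0 := ne_zero_of_mem_span hf0 hfg
  have hfhg : h * g = f := lquot_mul_cancel hg0 hfg
  have hh0 : h ≠ 0 := by intro h0; exact hf0 (by rw [← hfhg, h0, zero_mul])
  have hhu : ¬IsUnit h := fun hu => by
    obtain ⟨k, hk⟩ := hu.exists_left_inv
    exact hgf (Ideal.mem_span_singleton'.2 ⟨k, by rw [← hfhg, ← mul_assoc, hk, one_mul]⟩)
  -- The left factor is also a right divisor of `π`: `π g ∈ R f = R h g` because `π` is twosided,
  -- and `g` cancels.
  have hπh : π ∈ Ideal.span {h} :=
    mem_span_of_mul_mem_span hg0 (hfhg.symm ▸ hπ.1.mul_mem hπf g)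
  have hdeg : natDegree f = natDegree h + natDegree g := hfhg ▸ natDegree_mul hh0 hg0
  have hhpos := natDegree_pos_of_not_isUnit hh0 hhu
  have hgpos := natDegree_pos_of_not_isUnit hg0 hgu
  obtain ⟨L, hL, hLi, hLp⟩ := ih (natDegree h) (by omega) hπh hhu rfl
  obtain ⟨L', hL', hLi', hLp'⟩ := ih (natDegree g) (by omega)
    ((Ideal.span_singleton_le_iff_mem _).2 hfg hπf) hgu rfl
  refine ⟨L ++ L', fun n hn => ?_, ?_, by rw [List.prod_append, hLp, hLp', hfhg]⟩
  · obtain ⟨n, rfl⟩ : ∃ k, n = k + 1 := ⟨n - 1, by omega⟩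
    simp only [factorizeIrred, if_neg hf1, if_neg hsqrt, if_neg haux]
    rw [← hg, ← hh, hL n (by omega), hL' n (by omega)]
    rfl
  · intro p hp
    rcases List.mem_append.1 hp with hp | hp
    exacts [hLi p hp, hLi' p hp]

end

end OrePolynomial

/-! ### Bounds, and splitting along their twosided factors -/

namespace OrePolynomial

open Classical

variable {D : Type*} [DivisionRing D] {σ : D ≃+* D} {δ : SkewDerivation σ}

theorem mem_annihilator_iff {f x : OrePolynomial σ δ} :
    x ∈ Module.annihilator (OrePolynomial σ δ) (OrePolynomial σ δ ⧸ Ideal.span {f}) ↔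
      ∀ r, x * r ∈ Ideal.span {f} := by
  rw [Module.mem_annihilator]
  constructor
  · intro h r
    exact (Submodule.Quotient.mk_eq_zero _).1 (h (Submodule.Quotient.mk r))
  · intro h m
    obtain ⟨r, rfl⟩ := Submodule.Quotient.mk_surjective _ m
    exact (Submodule.Quotient.mk_eq_zero _).2 (h r)

theorem isBound_iff {f b : OrePolynomial σ δ} :
    IsBound f b ↔ IsTwosided b ∧ ∀ x, x ∈ Ideal.span {b} ↔ ∀ r, x * r ∈ Ideal.span {f} := by
  rw [IsBound, Ideal.ext_iff]
  simp_rw [mem_annihilator_iff]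

theorem IsBound.mem_span {f b : OrePolynomial σ δ} (h : IsBound f b) : b ∈ Ideal.span {f} := by
  simpa using ((isBound_iff.1 h).2 b).1 (Ideal.mem_span_singleton_self b) 1

/-- Minimality of the bound: `a R = R a ⊆ R f`, so `a` annihilates `R / R f`. -/
theorem IsBound.mem_of_twosided {f b a : OrePolynomial σ δ} (h : IsBound f b) (ha : IsTwosided a)
    (haf : a ∈ Ideal.span {f}) : a ∈ Ideal.span {b} :=
  ((isBound_iff.1 h).2 a).2 fun r => ha.mul_mem haf r

theorem notMem_span_mul {a b : OrePolynomial σ δ} (ha : a ≠ 0) (hb : ¬IsUnit b) :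
    a ∉ Ideal.span {b * a} := by
  intro h
  obtain ⟨k, hk⟩ := Ideal.mem_span_singleton'.1 h
  rw [← mul_assoc] at hk
  exact hb (IsUnit.of_mul_eq_one_right k (mul_right_cancel₀ ha (by rw [hk, one_mul])))

/-- An irreducible twosided right factor of a bound of `f` is a right factor of `f`. -/
theorem IsBound.mem_span_of_irreducible {f c p : OrePolynomial σ δ} (h : IsBound f (c * p))
    (hcp : c * p ≠ 0) (hp : IsTwosided p) (hpi : Irreducible p) :
    f ∈ Ideal.span {p} := by
  by_contra hne
  have hspan := span_rgd f p
  set d := rgd f p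
  obtain ⟨k, hk⟩ := Ideal.mem_span_singleton'.1
    (hspan ▸ Ideal.mem_sup_right (Ideal.mem_span_singleton_self p) : p ∈ Ideal.span {d})
  have hd : IsUnit d := by
    refine (hpi.isUnit_or_isUnit hk.symm).resolve_left fun hu => hne ?_
    obtain ⟨k', hk'⟩ := hu.exists_left_inv
    have hdp : d ∈ Ideal.span {p} :=
      Ideal.mem_span_singleton'.2 ⟨k', by rw [← hk, ← mul_assoc, hk', one_mul]⟩
    refine (Ideal.span_singleton_le_iff_mem _).2 hdp ?_
    rw [hspan]
    exact Ideal.mem_sup_left (Ideal.mem_span_singleton_self f)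
  have h1 : (1 : OrePolynomial σ δ) ∈ Ideal.span {f} ⊔ Ideal.span {p} := by
    rw [← hspan, Ideal.mem_span_singleton']
    exact hd.exists_left_inv
  obtain ⟨u, hu, v, hv, huv⟩ := Submodule.mem_sup.1 h1
  obtain ⟨a, rfl⟩ := Ideal.mem_span_singleton'.1 hu
  obtain ⟨b, rfl⟩ := Ideal.mem_span_singleton'.1 hv
  have hc0 : c ≠ 0 := left_ne_zero_of_mul hcp
  -- From `1 = a f + b p`, each `c r` equals `c r a f + c r b p`, and `r b p = p s` makes the last
  -- term `c p s ∈ R f`. So `c` lies in the annihilator, which its degree forbids.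
  have hc : c ∈ Ideal.span {c * p} := by
    rw [(isBound_iff.1 h).2]
    intro r
    obtain ⟨s, hs⟩ := hp.exists_mul_right (r * b)
    have : c * r = c * r * a * f + c * p * s := by
      rw [mul_assoc c p s, ← hs]
      calc c * r = c * r * (a * f + b * p) := by rw [huv, mul_one]
        _ = _ := by rw [mul_add]; simp only [mul_assoc]
    rw [this]
    exact add_mem (Ideal.mul_mem_left _ _ (Ideal.mem_span_singleton_self f))
      (h.1.mul_mem h.mem_span s)
  obtain ⟨k, hk⟩ := Ideal.mem_span_singleton'.1 hc
  have hk0 : k ≠ 0 := by rintro rfl; exact hc0 (by rw [← hk, zero_mul])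
  have h2 := natDegree_mul hk0 hcp
  rw [hk, natDegree_mul hc0 hpi.ne_zero] at h2
  have := natDegree_pos_of_not_isUnit hpi.ne_zero hpi.not_isUnit
  omega

/-- As `R p = p R` and `p` cancels, `x` annihilates `R / R f` exactly when `x p` annihilates `R / R
f p`. -/
theorem IsBound.of_mul_right {f c p : OrePolynomial σ δ} (h : IsBound (f * p) (c * p))
    (hc : IsTwosided c) (hp : IsTwosided p) (hp0 : p ≠ 0) : IsBound f c := by
  refine isBound_iff.2 ⟨hc, fun x => ⟨fun hx r => ?_, fun hx => ?_⟩⟩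
  · obtain ⟨k, rfl⟩ := Ideal.mem_span_singleton'.1 hx
    rw [mul_assoc]
    refine Ideal.mul_mem_left _ _ (mem_span_of_mul_mem_span hp0 ?_)
    obtain ⟨s, hs⟩ := hp.exists_mul_right r
    rw [mul_assoc, hs, ← mul_assoc]
    exact h.1.mul_mem h.mem_span s
  · refine mem_span_of_mul_mem_span hp0 (((isBound_iff.1 h).2 _).2 fun r => ?_)
    obtain ⟨s, hs⟩ := hp.exists_mul_left r
    rw [mul_assoc, hs, ← mul_assoc]
    obtain ⟨k, hk⟩ := Ideal.mem_span_singleton'.1 (hx s)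
    exact Ideal.mem_span_singleton'.2 ⟨k, by rw [← hk, mul_assoc]⟩

/-- Irreducible twosided factors of a bound of `f` can be split off on the right of `f`. -/
theorem IsBound.exists_eq_mul_prod {νs : List (OrePolynomial σ δ)} {f h : OrePolynomial σ δ}
    (hν : ∀ ν ∈ νs, Irreducible ν ∧ IsTwosided ν) (hh : h ∈ Subring.center (OrePolynomial σ δ))
    (hb : IsBound f (νs.prod * h)) (h0 : νs.prod * h ≠ 0) :
    ∃ f₁, f = f₁ * νs.prod ∧ IsBound f₁ h := by
  -- Factors leave `f` on the right, so the induction removes the last one; centrality of `h` brings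
  -- it to the right end of the bound.
  induction νs using List.reverseRecOn generalizing f with
  | nil => exact ⟨f, by simp, by simpa using hb⟩
  | append_singleton νs p ih =>
    have hp := hν p (by simp)
    have heq : (νs ++ [p]).prod * h = νs.prod * h * p := by
      rw [List.prod_append, List.prod_singleton, mul_assoc, mul_assoc, Subring.mem_center_iff.1 hh]
    rw [heq] at hb h0
    obtain ⟨f', rfl⟩ := Ideal.mem_span_singleton'.1 (hb.mem_span_of_irreducible h0 hp.2 hp.1)
    have hν' : ∀ ν ∈ νs, Irreducible ν ∧ IsTwosided ν := fun ν hν' => hν ν (by simp [hν'])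
    have htwo : IsTwosided (νs.prod * h) :=
      (isTwosided_list_prod fun ν hm => (hν' ν hm).2).mul (isTwosided_of_mem_center hh)
    obtain ⟨f₁, rfl, hf₁⟩ := ih hν' (hb.of_mul_right htwo hp.2 hp.1.ne_zero)
      (left_ne_zero_of_mul h0)
    exact ⟨f₁, by rw [List.prod_append, List.prod_singleton, mul_assoc], hf₁⟩

/-- The loop splits a polynomial with bound `π₁ ⋯ πₛ` into nonconstant factors `gᵢ`, and `gᵢ` is a
right divisor of `πᵢ`. -/
theorem splitLoop_spec {πs : List (OrePolynomial σ δ)} (hne : πs ≠ [])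
    (hπ : ∀ π ∈ πs, IsPrimeTwosided π) {f : OrePolynomial σ δ} (hf : IsBound f πs.prod) :
    (∀ p ∈ splitLoop f πs, IsPrimeTwosided p.2 ∧ p.2 ∈ Ideal.span {p.1} ∧ ¬IsUnit p.1) ∧
      ((splitLoop f πs).map Prod.fst).prod = f := by
  induction πs generalizing f with
  | nil => exact absurd rfl hne
  | cons π πs ih =>
  have hπ1 := hπ π (by simp)
  have hπu : ¬IsUnit π := fun hu => hπ1.2.1.ne' (isUnit_iff.1 hu).2
  cases πs with
  | nil =>
    rw [List.prod_singleton] at hf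
    simp only [splitLoop, List.mem_singleton, forall_eq, List.map_cons, List.map_nil,
      List.prod_singleton, and_true]
    refine ⟨hπ1, hf.mem_span, fun hu => hπu ?_⟩
    obtain ⟨k, hk⟩ := hu.exists_left_inv
    have h1 : (1 : OrePolynomial σ δ) ∈ Ideal.span {π} :=
      hf.mem_of_twosided (isTwosided_of_mem_center (one_mem _))
        (Ideal.mem_span_singleton'.2 ⟨k, hk⟩)
    obtain ⟨c, hc⟩ := Ideal.mem_span_singleton'.1 h1
    exact IsUnit.of_mul_eq_one_right c hc
  | cons π' πs =>
    have hπ' : ∀ p ∈ π' :: πs, IsPrimeTwosided p := fun p hp => hπ p (List.mem_cons_of_mem _ hp)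
    rw [List.prod_cons] at hf
    rw [splitLoop]
    set P := (π' :: πs).prod with hP
    have hPt : IsTwosided P := isTwosided_list_prod fun p hp => (hπ' p hp).1
    have hP0 : P ≠ 0 := List.prod_ne_zero fun h => (hπ' 0 h).ne_zero rfl
    have hf0 : f ≠ 0 := ne_zero_of_mem_span (mul_ne_zero hπ1.ne_zero hP0) hf.mem_span
    have hspan := span_rgd f P
    set f' := rgd f P
    have hff' : f ∈ Ideal.span {f'} :=
      hspan ▸ Ideal.mem_sup_left (Ideal.mem_span_singleton_self f)
    have hPf' : P ∈ Ideal.span {f'} :=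
      hspan ▸ Ideal.mem_sup_right (Ideal.mem_span_singleton_self P)
    have hf'0 := ne_zero_of_mem_span hf0 hff'
    have hg := lquot_mul_cancel hf'0 hff'
    -- Write `f' = a f + b P`. Since `π b = b' π`, the second term contributes `b' π P`, a multiple
    -- of the bound `π P` of `f`.
    have hπf' : π * f' ∈ Ideal.span {f} := by
      obtain ⟨u, hu, v, hv, huv⟩ := Submodule.mem_sup.1
        (hspan ▸ Ideal.mem_span_singleton_self f' : f' ∈ Ideal.span {f} ⊔ Ideal.span {P})
      obtain ⟨b, rfl⟩ := Ideal.mem_span_singleton'.1 hv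
      obtain ⟨b', hb'⟩ := hπ1.1.exists_mul_left b
      rw [← huv, mul_add, ← mul_assoc, hb', mul_assoc]
      exact add_mem (Ideal.mul_mem_left _ _ hu) (Ideal.mul_mem_left _ _ hf.mem_span)
    have hbound : IsBound f' P := by
      refine isBound_iff.2 ⟨hPt, fun x => ⟨fun hx r => ?_, fun hx => ?_⟩⟩
      · obtain ⟨k, rfl⟩ := Ideal.mem_span_singleton'.1 hx
        rw [mul_assoc]
        exact Ideal.mul_mem_left _ _ (hPt.mul_mem hPf' r)
      -- If `x` annihilates `R / R f'`, then `π x` annihilates `R / R f` because `π f' ∈ R f`. The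
      -- bound of `f` applies, and `π` is cancelled on the left.
      · have h1 : π * x ∈ Ideal.span {π * P} := by
          refine ((isBound_iff.1 hf).2 _).2 fun r => ?_
          obtain ⟨k, hk⟩ := Ideal.mem_span_singleton'.1 (hx r)
          obtain ⟨k', hk'⟩ := hπ1.1.exists_mul_left k
          rw [mul_assoc, ← hk, ← mul_assoc, hk', mul_assoc]
          exact Ideal.mul_mem_left _ _ hπf'
        obtain ⟨k, hk⟩ := Ideal.mem_span_singleton'.1 h1
        obtain ⟨k', hk'⟩ := hπ1.1.exists_mul_right k
        rw [← mul_assoc, hk', mul_assoc] at hk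
        exact Ideal.mem_span_singleton'.2 ⟨k', mul_left_cancel₀ hπ1.ne_zero hk⟩
    obtain ⟨ih1, ih2⟩ := ih (by simp) hπ' hbound
    constructor
    · intro p hp
      rcases List.mem_cons.1 hp with rfl | hp
      -- A unit quotient would give `R f' = R f`, so that `P ∈ R f`. Then `P` would be a multiple of
      -- the bound `π P`.
      · refine ⟨hπ1, mem_span_of_mul_mem_span hf'0 (hg.symm ▸ hπf'), fun hu => ?_⟩
        obtain ⟨k, hk⟩ := hu.exists_left_inv
        have hf'f : f' ∈ Ideal.span {f} :=
          Ideal.mem_span_singleton'.2 ⟨k, by rw [← hg, ← mul_assoc, hk, one_mul]⟩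
        have h1 := hf.mem_of_twosided hPt ((Ideal.span_singleton_le_iff_mem _).2 hf'f hPf')
        exact notMem_span_mul hP0 hπu h1
      · exact ih1 p hp
    · rw [List.map_cons, List.prod_cons, ih2, hg]

/-! ### Assembling the factorization -/

theorem exists_mapM_factorizeIrred {S : Subroutines σ δ}
    {L : List (OrePolynomial σ δ × OrePolynomial σ δ)}
    (h : ∀ p ∈ L, ∃ out : List (OrePolynomial σ δ),
      (∀ n ≥ natDegree p.1, factorizeIrred S n p.1 p.2 = some out) ∧
        (∀ q ∈ out, Irreducible q) ∧ out.prod = p.1) :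
    ∃ (outs : List (List (OrePolynomial σ δ))) (N : ℕ),
      (∀ n ≥ N, (L.mapM fun p => factorizeIrred S n p.1 p.2) = some outs) ∧
        (∀ q ∈ outs.flatten, Irreducible q) ∧ outs.flatten.prod = (L.map Prod.fst).prod := by
  induction L with
  | nil => exact ⟨[], 0, by simp⟩
  | cons p L ih =>
    obtain ⟨out, h1, h2, h3⟩ := h p (by simp)
    obtain ⟨outs, N, h4, h5, h6⟩ := ih fun q hq => h q (by simp [hq])
    refine ⟨out :: outs, max (natDegree p.1) N, fun n hn => ?_, ?_, ?_⟩
    · rw [List.mapM_cons, h1 n (le_of_max_le_left hn), h4 n (le_of_max_le_right hn)]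
      rfl
    · intro q hq
      rw [List.flatten_cons] at hq
      rcases List.mem_append.1 hq with hq | hq
      exacts [h2 q hq, h5 q hq]
    · rw [List.flatten_cons, List.prod_append, List.map_cons, List.prod_cons, h3, h6]

theorem span_const_mul {d : D} (hd : d ≠ 0) (f : OrePolynomial σ δ) :
    Ideal.span {const d * f} = Ideal.span {f} := by
  apply le_antisymm <;> rw [Ideal.span_singleton_le_iff_mem, Ideal.mem_span_singleton']
  · exact ⟨_, rfl⟩
  · exact ⟨const d⁻¹, by rw [← mul_assoc, const_mul_const, inv_mul_cancel₀ hd, const_one, one_mul]⟩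

end OrePolynomial

open OrePolynomial in
theorem theorem6p2 {D : Type*} [DivisionRing D] (σ : D ≃+* D) (δ : SkewDerivation σ)
    (K : Subfield D) (z : OrePolynomial σ δ) (hR : OrePolynomial.CenterConditions K z)
    (S : OrePolynomial.Subroutines σ δ) (hS : S.Correct)
    (f : OrePolynomial σ δ) (hf : 0 < f.natDegree)
    (hb : ∃ b ∈ Subring.center (OrePolynomial σ δ), b ≠ 0 ∧ OrePolynomial.IsBound f b) :
    ∃ (out : List (OrePolynomial σ δ)) (N : ℕ),
      (∀ n ≥ N, OrePolynomial.factorize S n f = some out) ∧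
      (∀ p ∈ out, Irreducible p) ∧ out.prod = f := by
  have := hR.free
  have := hR.finite
  obtain ⟨b, -, hb0, hb⟩ := hb
  have hfu : ¬IsUnit f := fun hu => hf.ne' (isUnit_iff.1 hu).2
  have hbound := hS.isBound f
  have hν := hS.tame_spec f
  have hνh : (S.tame f).prod * S.hat f ≠ 0 :=
    -- The computed bound and the given nonzero one generate the same annihilator, so the computed
    -- one is nonzero.
    ne_zero_of_mem_span hb0 (by rw [hbound.2, ← hb.2]; exact Ideal.mem_span_singleton_self b)
  obtain ⟨f₁, hff₁, hf₁⟩ := hbound.exists_eq_mul_prod hν (hS.hat_mem f) hνh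
  have hlquot : lquot f (S.tame f).prod = f₁ := by
    have h := lquot_mul_right (left_ne_zero_of_mul hνh) f₁
    rwa [← hff₁] at h
  have hh0 : S.hat f ≠ 0 := right_ne_zero_of_mul hνh
  have hhat := isTwosided_of_mem_center (hS.hat_mem f)
  obtain ⟨d, hd, hfac⟩ := hS.factor_prod _ hh0 hhat
  have hprime := hS.factor_prime _ hh0 hhat
  cases hs : S.factor (S.hat f) with
  | nil =>
    rw [hs, List.prod_nil, mul_one] at hfac
    -- Here `f̂` is the nonzero constant `d`, and `f₁` is a right divisor of it. Absorbing this unit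
    -- keeps `ν₁` irreducible, and the list of the `νᵢ` is nonempty because `f` is nonconstant.
    have hu : IsUnit f₁ := by
      have h1 := hf₁.mem_span
      rw [hfac] at h1
      obtain ⟨k, hk⟩ := Ideal.mem_span_singleton'.1 h1
      exact (IsUnit.mul_iff.1 (hk ▸ isUnit_const hd)).2
    refine ⟨absorb f₁ (S.tame f), 0, fun n _ => ?_, ?_, ?_⟩
    · simp only [factorize, hs, hlquot]
    · cases ht : S.tame f with
      | nil => simp [absorb]
      | cons ν νs =>
        intro p hp
        rw [ht] at hν
        rcases List.mem_cons.1 hp with rfl | hp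
        · obtain ⟨u, rfl⟩ := hu
          exact (irreducible_units_mul u).2 (hν ν (by simp)).1
        · exact (hν p (by simp [hp])).1
    · cases ht : S.tame f with
      | nil =>
        rw [ht, List.prod_nil, mul_one] at hff₁
        exact absurd (hff₁ ▸ hu) hfu
      | cons ν νs => rw [absorb, List.prod_cons, mul_assoc, ← List.prod_cons, ← ht, ← hff₁]
  | cons π πs =>
    rw [hs] at hfac hprime
    -- The constant `d` does not change the left ideal, so it can be dropped from the bound.
    have hbound₁ : IsBound f₁ (π :: πs).prod :=
      ⟨isTwosided_list_prod fun p hp => (hprime p hp).1, by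
        rw [← hf₁.2, hfac, span_const_mul hd]⟩
    obtain ⟨h1, h2⟩ := splitLoop_spec (by simp) hprime hbound₁
    obtain ⟨outs, N, h3, h4, h5⟩ := exists_mapM_factorizeIrred (S := S) fun p hp =>
      exists_factorizeIrred hS (h1 p hp).1 (h1 p hp).2.1 (h1 p hp).2.2
    refine ⟨outs.flatten ++ S.tame f, N, fun n hn => ?_, ?_, ?_⟩
    · simp only [factorize, hs, hlquot, h3 n hn]
      rfl
    · intro p hp
      rcases List.mem_append.1 hp with hp | hp
      exacts [h4 p hp, (hν p hp).1]
    · rw [List.prod_append, h5, h2, ← hff₁]
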